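/- We work on a unit-cost real RAM. A machine cell stores either a real number or a natural number (a word). In one step the machine reads or writes a cell (the address may be a computed word), loads a constant (a natural number or a rational number), performs one operation $+,-,\times,\div$ on two reals or on two words (subtraction of words is truncated at $0$, division of words is rounded down, division by $0$ is not allowed), or makes one comparison or logical operation in a test. Programs are built from assignments by composition, branching and loops. Reals cannot be rounded or converted into words. A program refers to a fixed finite number of arrays of cells; it runs in space $S$ if all addresses it uses and all words it computes are smaller than $S$ (so it uses $O(S)$ cells, and words of at most $\log_2 S$ bits). **Theorem.** There are a program for this machine and functions $T,S:\mathbb{N}\to\mathbb{N}$ with $T(n)=O(n^4\log n)$ and $S(n)=O(n)$ such that the following holds. Let $p_1,\dots,p_n$ ($n\ge 0$) be points in the plane, no two of which have the same $x$-coordinate or the same $y$-coordinate, and let $\omega(p_1),\dots,\omega(p_n)\in\mathbb{R}$ be weights of arbitrary sign. Given $n$ and the coordinates and weights of the points (stored in arrays, all other cells being $0$), the program halts after at most $T(n)$ steps, in space $S(n)$, and outputs two (possibly overlapping) axis-aligned rectangles $A=[a_1,a_2]\times[a_3,a_4]$ and $B=[b_1,b_2]\times[b_3,b_4]$, where $a_1<a_2$,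 $a_3<a_4$, $b_1<b_2$, $b_3<b_4$, that maximize $$\sum_{i\,:\,p_i\in A\,\triangle\,B}\omega(p_i)$$ over all pairs of axis-aligned rectangles; it also outputs this maximum. -/

import Mathlib

/-! ## A unit-cost real RAM

The memory consists of arrays of word cells, which hold natural numbers, and arrays of real cells,
which hold real numbers. An array is named by a fixed number in the program text, so that each
program has finitely many arrays of each kind; the address inside an array may be computed. A
simple variable is the cell of an array at a constant address. The machine is run with a size
bound `N`: every address that is used and every word that is computed has to be smaller than `N`.
A run within the bound `N` of a program with `k` arrays therefore uses at most `k * N` memory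
cells, and its words have at most `log₂ N` bits. Real numbers can be added, subtracted,
multiplied, divided and compared, but not rounded or used as addresses. -/

namespace RealRAM

/-- A content of the memory: `σ.word a i` is the cell at address `i` of the word array `a`, and
`σ.real a i` is the cell at address `i` of the real array `a`. -/
structure State where
  word : ℕ → ℕ → ℕ
  real : ℕ → ℕ → ℝ

/-- Overwrite the cell at address `i` of the word array `a`. -/
def State.setWord (σ : State) (a i v : ℕ) : State where
  word := Function.update σ.word a (Function.update (σ.word a) i v)
  real := σ.real

/-- Overwrite the cell at address `i` of the real array `a`. -/
noncomputable def State.setReal (σ : State) (a i : ℕ) (v : ℝ) : State where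
  word := σ.word
  real := Function.update σ.real a (Function.update (σ.real a) i v)

/-- Expressions whose value is a word. -/
inductive WExpr where
  | const (k : ℕ)
  | cell (a : ℕ) (i : WExpr)
  | add (e f : WExpr)
  | sub (e f : WExpr)
  | mul (e f : WExpr)
  | div (e f : WExpr)

namespace WExpr

/-- The value; subtraction is truncated at zero, division is rounded down. -/
def eval (σ : State) : WExpr → ℕ
  | const k => k
  | cell a i => σ.word a (i.eval σ)
  | add e f => e.eval σ + f.eval σ
  | sub e f => e.eval σ - f.eval σ
  | mul e f => e.eval σ * f.eval σ
  | div e f => e.eval σ / f.eval σ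

/-- The evaluation neither leaves the memory, nor overflows, nor divides by zero. -/
def Ok (N : ℕ) (σ : State) : WExpr → Prop
  | const k => k < N
  | cell _ i => i.Ok N σ ∧ i.eval σ < N
  | add e f => e.Ok N σ ∧ f.Ok N σ ∧ e.eval σ + f.eval σ < N
  | sub e f => e.Ok N σ ∧ f.Ok N σ
  | mul e f => e.Ok N σ ∧ f.Ok N σ ∧ e.eval σ * f.eval σ < N
  | div e f => e.Ok N σ ∧ f.Ok N σ ∧ f.eval σ ≠ 0

/-- The number of steps of the evaluation: one for each constant, memory access, operation. -/
def cost : WExpr → ℕ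
  | const _ => 1
  | cell _ i => i.cost + 1
  | add e f => e.cost + f.cost + 1
  | sub e f => e.cost + f.cost + 1
  | mul e f => e.cost + f.cost + 1
  | div e f => e.cost + f.cost + 1

end WExpr

/-- Expressions whose value is a real number. -/
inductive RExpr where
  | const (q : ℚ)
  | cell (a : ℕ) (i : WExpr)
  | add (e f : RExpr)
  | sub (e f : RExpr)
  | mul (e f : RExpr)
  | div (e f : RExpr)

namespace RExpr

/-- The value. -/
noncomputable def eval (σ : State) : RExpr → ℝ
  | const q => (q : ℝ)
  | cell a i => σ.real a (i.eval σ)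
  | add e f => e.eval σ + f.eval σ
  | sub e f => e.eval σ - f.eval σ
  | mul e f => e.eval σ * f.eval σ
  | div e f => e.eval σ / f.eval σ

/-- The evaluation neither leaves the memory nor divides by zero. -/
def Ok (N : ℕ) (σ : State) : RExpr → Prop
  | const _ => True
  | cell _ i => i.Ok N σ ∧ i.eval σ < N
  | add e f => e.Ok N σ ∧ f.Ok N σ
  | sub e f => e.Ok N σ ∧ f.Ok N σ
  | mul e f => e.Ok N σ ∧ f.Ok N σ
  | div e f => e.Ok N σ ∧ f.Ok N σ ∧ f.eval σ ≠ 0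

/-- The number of steps of the evaluation: one for each constant, memory access, operation. -/
def cost : RExpr → ℕ
  | const _ => 1
  | cell _ i => i.cost + 1
  | add e f => e.cost + f.cost + 1
  | sub e f => e.cost + f.cost + 1
  | mul e f => e.cost + f.cost + 1
  | div e f => e.cost + f.cost + 1

end RExpr

/-- Tests. -/
inductive Test where
  | wordEq (e f : WExpr)
  | wordLt (e f : WExpr)
  | realLt (e f : RExpr)
  | neg (b : Test)
  | conj (b c : Test)

namespace Test

/-- The test succeeds. -/
def Holds (σ : State) : Test → Prop
  | wordEq e f => e.eval σ = f.eval σ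
  | wordLt e f => e.eval σ < f.eval σ
  | realLt e f => e.eval σ < f.eval σ
  | neg b => ¬ b.Holds σ
  | conj b c => b.Holds σ ∧ c.Holds σ

/-- All expressions in the test can be evaluated. -/
def Ok (N : ℕ) (σ : State) : Test → Prop
  | wordEq e f => e.Ok N σ ∧ f.Ok N σ
  | wordLt e f => e.Ok N σ ∧ f.Ok N σ
  | realLt e f => e.Ok N σ ∧ f.Ok N σ
  | neg b => b.Ok N σ
  | conj b c => b.Ok N σ ∧ c.Ok N σ

/-- The number of steps of the test. -/
def cost : Test → ℕ
  | wordEq e f => e.cost + f.cost + 1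
  | wordLt e f => e.cost + f.cost + 1
  | realLt e f => e.cost + f.cost + 1
  | neg b => b.cost + 1
  | conj b c => b.cost + c.cost + 1

end Test

/-- Programs: assignments to a memory cell, composition, branching, and loops. -/
inductive Program where
  | nop
  | setWord (a : ℕ) (i e : WExpr)
  | setReal (a : ℕ) (i : WExpr) (e : RExpr)
  | seq (P Q : Program)
  | branch (b : Test) (P Q : Program)
  | loop (b : Test) (P : Program)

/-- `P.Exec N σ t τ`: started with memory content `σ`, the program `P` halts after exactly `t`
steps with memory content `τ`, and stays within the size bound `N` throughout. -/
inductive Program.Exec (N : ℕ) : Program → State → ℕ → State → Prop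
  | nop (σ : State) : Exec N nop σ 1 σ
  | setWord (a : ℕ) (i e : WExpr) (σ : State)
      (hi : i.Ok N σ) (hN : i.eval σ < N) (he : e.Ok N σ) :
      Exec N (setWord a i e) σ (i.cost + e.cost + 1) (σ.setWord a (i.eval σ) (e.eval σ))
  | setReal (a : ℕ) (i : WExpr) (e : RExpr) (σ : State)
      (hi : i.Ok N σ) (hN : i.eval σ < N) (he : e.Ok N σ) :
      Exec N (setReal a i e) σ (i.cost + e.cost + 1) (σ.setReal a (i.eval σ) (e.eval σ))
  | seq {P Q : Program} {σ τ υ : State} {s t : ℕ} (hP : Exec N P σ s τ) (hQ : Exec N Q τ t υ) :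
      Exec N (seq P Q) σ (s + t) υ
  | branch_pos {b : Test} {P Q : Program} {σ τ : State} {t : ℕ}
      (hb : b.Ok N σ) (h : b.Holds σ) (hP : Exec N P σ t τ) :
      Exec N (branch b P Q) σ (b.cost + t) τ
  | branch_neg {b : Test} {P Q : Program} {σ τ : State} {t : ℕ}
      (hb : b.Ok N σ) (h : ¬ b.Holds σ) (hQ : Exec N Q σ t τ) :
      Exec N (branch b P Q) σ (b.cost + t) τ
  | loop_done {b : Test} {P : Program} {σ : State} (hb : b.Ok N σ) (h : ¬ b.Holds σ) :
      Exec N (loop b P) σ b.cost σ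
  | loop_step {b : Test} {P : Program} {σ τ υ : State} {s t : ℕ}
      (hb : b.Ok N σ) (h : b.Holds σ) (hP : Exec N P σ s τ) (hL : Exec N (loop b P) τ t υ) :
      Exec N (loop b P) σ (b.cost + s + t) υ

end RealRAM

/-! ## The maximum-weight two boxes symmetric difference problem -/

namespace TwoBoxes

/-- An axis-aligned rectangle (box) in the plane. -/
structure Box where
  x₁ : ℝ
  x₂ : ℝ
  y₁ : ℝ
  y₂ : ℝ
  hx : x₁ < x₂
  hy : y₁ < y₂

/-- The points of a box. -/
def Box.toSet (A : Box) : Set (ℝ × ℝ) := Set.Icc A.x₁ A.x₂ ×ˢ Set.Icc A.y₁ A.y₂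

/-- No two points are vertically or horizontally aligned. -/
def GeneralPosition {n : ℕ} (p : Fin n → ℝ × ℝ) : Prop :=
  Function.Injective (fun i => (p i).1) ∧ Function.Injective (fun i => (p i).2)

open Classical in
/-- The total weight of the points in the symmetric difference of two boxes. -/
noncomputable def symmDiffWeight {n : ℕ} (p : Fin n → ℝ × ℝ) (w : Fin n → ℝ) (A B : Box) : ℝ :=
  ∑ i with p i ∈ symmDiff A.toSet B.toSet, w i

/-- The input: the number `n` of points is in cell `0` of the word array `0`; the abscissae, the
ordinates and the weights of the points are in the first `n` cells of the real arrays `0`, `1` and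
`2`. All other cells are zero. -/
noncomputable def inputState {n : ℕ} (p : Fin n → ℝ × ℝ) (w : Fin n → ℝ) : RealRAM.State where
  word a i := if a = 0 ∧ i = 0 then n else 0
  real a i :=
    if h : i < n then
      if a = 0 then (p ⟨i, h⟩).1
      else if a = 1 then (p ⟨i, h⟩).2
      else if a = 2 then w ⟨i, h⟩
      else 0
    else 0

/-- The output: the first nine cells of the real array `3` hold the coordinates of the box `A`,
those of the box `B`, and the number `v`. -/
def IsOutput (σ : RealRAM.State) (A B : Box) (v : ℝ) : Prop :=
  σ.real 3 0 = A.x₁ ∧ σ.real 3 1 = A.x₂ ∧ σ.real 3 2 = A.y₁ ∧ σ.real 3 3 = A.y₂ ∧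
  σ.real 3 4 = B.x₁ ∧ σ.real 3 5 = B.x₂ ∧ σ.real 3 6 = B.y₁ ∧ σ.real 3 7 = B.y₂ ∧
  σ.real 3 8 = v

end TwoBoxes

/-!
Write `A △ B` for the symmetric difference of the boxes. Whether a point lies in `A △ B` depends
only on how the ranks of its two coordinates compare with the ranks at which the sides of the boxes
cut the sorted coordinates (`exists_rank_interval`, `symmDiffWeight_eq_total`), and every choice of
cuts comes from two boxes, whose sides are put strictly between consecutive coordinates
(`lowerThird_le_iff`, `le_upperThird_iff`). So there are `O(n ^ 4)` choices for the four horizontal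
sides, and it remains to find, for each of them, the best vertical sides in time `O(log n)`.

For fixed horizontal sides the problem is one-dimensional. Scanned by abscissa, each of the two
boxes is in one of three states (before, inside, behind), and the weight that a point contributes is
a function of the pair of states. A node of a segment tree over the points in the order of their
abscissae keeps, for each pair of states at the left end and each pair of states at the right end of
its range, the best pair of intervals together with its value. Entries of adjacent ranges are
combined by maximizing over the states at the border (`isOpt_join`), so a node is computed from its
children in constant time (`computeNode_wp`). When the upper side of `B` passes a point, only the
weights of one leaf change, and it suffices to recompute the `O(log n)` nodes above it
(`updateTree_runs`). For each choice of the other three horizontal sides the tree is built anew in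
time `O(n)` (`buildTree_runs`). This gives the total time `O(n ^ 4 * log n)` (`search_runs`).

Programs are verified by a weakest precondition calculus for the loop-free parts (`Runs.of_wp`) and
invariants for the loops (`Runs.loop`, `Runs.forUp`), with time bounds built in.

The memory is laid out as follows; the cells at address `0` serve as simple variables.
* Word array `0`: `n`; `1`: the number `m` of leaves; `2`, `3`: the rank of the ordinate by the rank
  of the abscissa, and conversely; `4`, …, `7`: `i`, `j`, `k`, `l`, where the ordinates of `A` and
  `B` have their ranks in `[i, j)` and `[k, l)`; `8`: the current node; `9`, …, `12`: counters and
  point numbers used in sorting; `20`, …, `27`: the best solution so far.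
* Real arrays `0`, `1`, `2`: the input; `3`: the output; `4`, `5`: the sorted abscissae and
  ordinates; `6`: the weights by rank of the abscissa; `7`: the weights of the current leaf.
* Arrays from `100` on: the entries of the tree, indexed by nodes.
-/

/-! ### Reasoning about programs -/

namespace RealRAM

@[simp] theorem State.word_setWord (σ : State) (a i v b j : ℕ) :
    (σ.setWord a i v).word b j = if b = a ∧ j = i then v else σ.word b j := by
  unfold State.setWord
  by_cases hb : b = a
  · subst hb; by_cases hj : j = i <;> simp [hj]
  · simp [hb]

@[simp] theorem State.real_setWord (σ : State) (a i v : ℕ) : (σ.setWord a i v).real = σ.real := rfl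

@[simp] theorem State.real_setReal (σ : State) (a i b j : ℕ) (v : ℝ) :
    (σ.setReal a i v).real b j = if b = a ∧ j = i then v else σ.real b j := by
  unfold State.setReal
  by_cases hb : b = a
  · subst hb; by_cases hj : j = i <;> simp [hj]
  · simp [hb]

@[simp] theorem State.word_setReal (σ : State) (a i : ℕ) (v : ℝ) :
    (σ.setReal a i v).word = σ.word := rfl

theorem State.word_setWord_of_ne (σ : State) {a b : ℕ} (i v : ℕ) (h : b ≠ a) :
    (σ.setWord a i v).word b = σ.word b := by
  simp [State.setWord, h]

theorem State.real_setReal_of_ne (σ : State) {a b : ℕ} (i : ℕ) (v : ℝ) (h : b ≠ a) :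
    (σ.setReal a i v).real b = σ.real b := by
  simp [State.setReal, h]

attribute [simp] WExpr.eval WExpr.Ok RExpr.eval RExpr.Ok Test.Holds Test.Ok

/-- Total correctness with a time bound: started in `σ`, the program halts within `c` steps and
within the size bound `N`, and the final state satisfies `Q`. -/
def Runs (N : ℕ) (P : Program) (σ : State) (c : ℕ) (Q : State → Prop) : Prop :=
  ∃ t τ, P.Exec N σ t τ ∧ t ≤ c ∧ Q τ

namespace Program

/-- The weakest precondition of a loop-free program. -/
def wp (N : ℕ) : Program → (State → Prop) → State → Prop
  | nop, Q, σ => Q σ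
  | setWord a i e, Q, σ =>
      i.Ok N σ ∧ i.eval σ < N ∧ e.Ok N σ ∧ Q (σ.setWord a (i.eval σ) (e.eval σ))
  | setReal a i e, Q, σ =>
      i.Ok N σ ∧ i.eval σ < N ∧ e.Ok N σ ∧ Q (σ.setReal a (i.eval σ) (e.eval σ))
  | seq P P', Q, σ => P.wp N (P'.wp N Q) σ
  | branch b P P', Q, σ =>
      b.Ok N σ ∧ (b.Holds σ → P.wp N Q σ) ∧ (¬ b.Holds σ → P'.wp N Q σ)
  | loop _ _, _, _ => False

theorem wp_seq {N : ℕ} {P P' : Program} {Q : State → Prop} {σ : State} :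
    (seq P P').wp N Q σ ↔ P.wp N (P'.wp N Q) σ := Iff.rfl

/-- The worst-case number of steps of a loop-free program. -/
def maxCost : Program → ℕ
  | nop => 1
  | setWord _ i e => i.cost + e.cost + 1
  | setReal _ i e => i.cost + e.cost + 1
  | seq P P' => P.maxCost + P'.maxCost
  | branch b P P' => b.cost + max P.maxCost P'.maxCost
  | loop _ _ => 0

end Program

namespace Runs

variable {N : ℕ} {P P' : Program} {σ : State} {c c' : ℕ} {Q Q' : State → Prop}

theorem mono (h : Runs N P σ c Q) (hc : c ≤ c') (hQ : ∀ τ, Q τ → Q' τ) : Runs N P σ c' Q' := by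
  obtain ⟨t, τ, h, ht, hq⟩ := h
  exact ⟨t, τ, h, ht.trans hc, hQ τ hq⟩

theorem of_wp (h : P.wp N Q σ) : Runs N P σ P.maxCost Q := by
  induction P generalizing σ Q with
  | nop => exact ⟨1, σ, .nop σ, le_rfl, h⟩
  | setWord a i e => exact ⟨_, _, .setWord a i e σ h.1 h.2.1 h.2.2.1, le_rfl, h.2.2.2⟩
  | setReal a i e => exact ⟨_, _, .setReal a i e σ h.1 h.2.1 h.2.2.1, le_rfl, h.2.2.2⟩
  | seq P P' ih ih' =>
    obtain ⟨t, τ, h₁, ht, h⟩ := ih h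
    obtain ⟨t', υ, h₂, ht', h⟩ := ih' h
    exact ⟨_, _, .seq h₁ h₂, Nat.add_le_add ht ht', h⟩
  | branch b P P' ih ih' =>
    by_cases hb : b.Holds σ
    · obtain ⟨t, τ, h₁, ht, hq⟩ := ih (h.2.1 hb)
      exact ⟨_, _, .branch_pos h.1 hb h₁,
        Nat.add_le_add_left (ht.trans (le_max_left _ _)) _, hq⟩
    · obtain ⟨t, τ, h₁, ht, hq⟩ := ih' (h.2.2 hb)
      exact ⟨_, _, .branch_neg h.1 hb h₁,
        Nat.add_le_add_left (ht.trans (le_max_right _ _)) _, hq⟩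
  | loop => exact h.elim

/-- A loop-free program takes constant time, whatever the input and the size bound. -/
theorem exists_cost (P : Program) :
    ∃ K, ∀ (N : ℕ) (σ : State) (Q : State → Prop), P.wp N Q σ → Runs N P σ K Q :=
  ⟨_, fun _ _ _ => of_wp⟩

theorem seq (h : Runs N P σ c fun τ => Runs N P' τ c' Q) : Runs N (.seq P P') σ (c + c') Q := by
  obtain ⟨t, τ, h₁, ht, t', υ, h₂, ht', hq⟩ := h
  exact ⟨_, _, .seq h₁ h₂, Nat.add_le_add ht ht', hq⟩

/-- A loop that is known to make exactly `b` rounds. -/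
theorem loop {b : Test} (I : ℕ → State → Prop) (r : ℕ)
    (hstep : ∀ k σ, k < r → I k σ → b.Ok N σ ∧ b.Holds σ ∧ Runs N P σ c (I (k + 1)))
    (hdone : ∀ σ, I r σ → b.Ok N σ ∧ ¬ b.Holds σ) (h : I 0 σ) :
    Runs N (.loop b P) σ (r * (b.cost + c) + b.cost) (I r) := by
  suffices H : ∀ d k σ, k + d = r → I k σ →
      Runs N (.loop b P) σ (d * (b.cost + c) + b.cost) (I r) from H r 0 σ (Nat.zero_add r) h
  intro d
  induction d with
  | zero =>
    intro k σ hk hI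
    obtain rfl : k = r := hk
    exact ⟨_, _, .loop_done (hdone σ hI).1 (hdone σ hI).2, by simp, hI⟩
  | succ d ih =>
    intro k σ hk hI
    obtain ⟨hb, hh, t, τ, h₁, ht, hI'⟩ := hstep k σ (by omega) hI
    obtain ⟨t', υ, h₂, ht', hI''⟩ := ih (k + 1) τ (by omega) hI'
    refine ⟨_, _, .loop_step hb hh h₁ h₂, ?_, hI''⟩
    rw [Nat.succ_mul]
    omega

end Runs

/-- The simple variable kept at address `0` of the word array `a`. -/
abbrev WExpr.var (a : ℕ) : WExpr := .cell a (.const 0)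

/-- Assignment to the simple variable `a`. -/
abbrev Program.assign (a : ℕ) (e : WExpr) : Program := .setWord a (.const 0) e

/-- `while v < e do (P; v := v + 1)`. -/
def Program.forUp (v : ℕ) (e : WExpr) (P : Program) : Program :=
  .loop (.wordLt (.var v) e) (.seq P (.assign v (.add (.var v) (.const 1))))

/-- A counting loop with at most `r` rounds of at most `K * M` steps each takes `O(r * M)`
steps. -/
theorem Runs.forUp {N : ℕ} {P : Program} {σ : State} {v : ℕ} {e : WExpr} {K M r a b : ℕ}
    (I : ℕ → State → Prop) (hab : a ≤ b) (hbN : b + 1 < N) (hM : 1 ≤ M)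
    (hr₀ : 1 ≤ r) (hr : b ≤ a + r)
    (he : ∀ k σ, I k σ → e.Ok N σ ∧ e.eval σ = b)
    (hbody : ∀ k σ, a ≤ k → k < b → σ.word v 0 = k → I k σ →
      Runs N P σ (K * M) fun τ => τ.word v 0 = k ∧ I (k + 1) (τ.setWord v 0 (k + 1)))
    (hv : σ.word v 0 = a) (hI : I a σ) :
    Runs N (.forUp v e P) σ ((K + 2 * e.cost + 12) * (r * M))
      fun τ => τ.word v 0 = b ∧ I b τ := by
  have key := Runs.loop (N := N) (P := .seq P (.assign v (.add (.var v) (.const 1)))) (σ := σ)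
    (b := .wordLt (.var v) e) (c := K * M + 6) (fun k σ => σ.word v 0 = a + k ∧ I (a + k) σ)
    (b - a) ?_ ?_ ?_
  · refine key.mono ?_ ?_
    · simp only [Test.cost, WExpr.cost]
      have h1 : b - a ≤ r := by omega
      have h2 : 1 ≤ r * M := Nat.mul_pos hr₀ hM
      have h3 : r ≤ r * M := Nat.le_mul_of_pos_right _ hM
      have h4 : (b - a) * (1 + 1 + e.cost + 1 + (K * M + 6)) ≤ r * (e.cost + 9 + K * M) :=
        Nat.mul_le_mul h1 (by omega)
      have h5 : r * (e.cost + 9 + K * M) = r * (e.cost + 9) + K * (r * M) := by ring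
      have h6 : r * (e.cost + 9) ≤ (r * M) * (e.cost + 9) := Nat.mul_le_mul_right _ h3
      have h7 : 1 * (e.cost + 3) ≤ (r * M) * (e.cost + 3) := Nat.mul_le_mul_right _ h2
      have h8 : (K + 2 * e.cost + 12) * (r * M)
        = K * (r * M) + (r * M) * (e.cost + 9) + (r * M) * (e.cost + 3) := by ring
      omega
    · rw [Nat.add_sub_cancel' hab]
      exact fun τ h => h
  · rintro k σ hk ⟨h₁, h₂⟩
    obtain ⟨h₃, h₄⟩ := he _ σ h₂
    refine ⟨⟨⟨show 0 < N by omega, show 0 < N by omega⟩, h₃⟩, ?_, Runs.seq ?_⟩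
    · simp only [Test.Holds, WExpr.eval, h₁, h₄]; omega
    · refine (hbody (a + k) σ (by omega) (by omega) h₁ h₂).mono le_rfl ?_
      rintro τ ⟨h₅, h₆⟩
      refine Runs.mono (Runs.of_wp (Q := fun τ => τ.word v 0 = a + (k + 1) ∧ I (a + (k + 1)) τ) ?_)
        (show _ ≤ 6 by simp [Program.maxCost, WExpr.cost]) (fun _ h => h)
      simp only [Program.wp, WExpr.Ok, WExpr.eval, h₅, State.word_setWord, and_self,
        if_true]
      exact ⟨by omega, by omega, ⟨by omega, by omega, by omega⟩, by omega, h₆⟩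
  · rintro σ ⟨h₁, h₂⟩
    obtain ⟨h₃, h₄⟩ := he _ σ h₂
    refine ⟨⟨⟨show 0 < N by omega, show 0 < N by omega⟩, h₃⟩, ?_⟩
    simp only [Test.Holds, WExpr.eval, h₁, h₄]; omega
  · exact ⟨hv, hI⟩

end RealRAM

/-! ### Two intervals on a line -/

namespace TwoBoxes

/-- Relative to an interval `[a₁, a₂)` a position is in state `0` before the interval, in state `1`
inside, and in state `2` behind it. `Segment l r s t a₁ a₂` says that `[a₁, a₂)` is an interval
inside `[l, r]` for which the positions `l, …, r - 1` only take states between `s` and `t`; an end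
of the interval that has been passed before `l` is recorded as `l`, and one that is still to come
behind `r - 1` as `r`. -/
def Segment (l r s t a₁ a₂ : ℕ) : Prop :=
  l ≤ a₁ ∧ a₁ ≤ a₂ ∧ a₂ ≤ r ∧ (1 ≤ s → a₁ = l) ∧ (2 ≤ s → a₂ = l) ∧ (t < 1 → a₁ = r) ∧
    (t < 2 → a₂ = r)

theorem Segment.join {l m r s u t a₁ a₂ b₁ b₂ : ℕ} (hlm : l < m) (hmr : m < r)
    (hs : s ≤ u) (ht : u ≤ t) (h : Segment l m s u a₁ a₂) (h' : Segment m r u t b₁ b₂) :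
    Segment l r s t (if 1 ≤ u then a₁ else b₁) (if 2 ≤ u then a₂ else b₂) := by
  unfold Segment at *
  split_ifs <;> omega

theorem Segment.join_mem_left {l m r s u t a₁ a₂ b₁ b₂ c : ℕ}
    (h : Segment l m s u a₁ a₂) (h' : Segment m r u t b₁ b₂) (hc : c < m) :
    ((if 1 ≤ u then a₁ else b₁) ≤ c ∧ c < if 2 ≤ u then a₂ else b₂) ↔ a₁ ≤ c ∧ c < a₂ := by
  unfold Segment at *
  split_ifs <;> omega

theorem Segment.join_mem_right {l m r s u t a₁ a₂ b₁ b₂ c : ℕ}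
    (h : Segment l m s u a₁ a₂) (h' : Segment m r u t b₁ b₂) (hc : m ≤ c) (hr : c < r) :
    ((if 1 ≤ u then a₁ else b₁) ≤ c ∧ c < if 2 ≤ u then a₂ else b₂) ↔ b₁ ≤ c ∧ c < b₂ := by
  unfold Segment at *
  split_ifs <;> omega

/-- An interval is cut at `m`, where `u` is the state in which it passes from the left part to the
right part. -/
theorem Segment.split {l m r s t a₁ a₂ : ℕ} (hlm : l < m) (hmr : m < r) (ht : t ≤ 2)
    (hst : s ≤ t) (h : Segment l r s t a₁ a₂) :
    ∃ u, s ≤ u ∧ u ≤ t ∧ Segment l m s u (min a₁ m) (min a₂ m) ∧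
      Segment m r u t (max a₁ m) (max a₂ m) := by
  unfold Segment at *
  by_cases h₁ : m ≤ a₁
  · exact ⟨0, by omega, by omega, by omega, by omega⟩
  · by_cases h₂ : m ≤ a₂
    · by_cases h₃ : s ≤ 1
      · exact ⟨1, by omega, by omega, by omega, by omega⟩
      · exact ⟨2, by omega, by omega, by omega, by omega⟩
    · exact ⟨2, by omega, by omega, by omega, by omega⟩

theorem segment_succ_iff {c s t a₁ a₂ : ℕ} (hst : s ≤ t) (ht : t ≤ 2) :
    Segment c (c + 1) s t a₁ a₂ ↔ ∃ u, s ≤ u ∧ u ≤ t ∧ a₁ = (if 1 ≤ u then c else c + 1) ∧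
      a₂ = if 2 ≤ u then c else c + 1 := by
  unfold Segment
  constructor
  · intro h
    by_cases h₁ : a₁ = c + 1
    · exact ⟨0, by omega, by omega, by simpa using h₁, by simp; omega⟩
    · by_cases h₂ : a₂ = c + 1
      · exact ⟨1, by omega, by omega, by simp; omega, by simp; omega⟩
      · exact ⟨2, by omega, by omega, by simp; omega, by simp; omega⟩
  · rintro ⟨u, hu⟩
    split_ifs at hu <;> omega

/-- The states of two intervals at the left end (`sA`, `sB`) and at the right end (`tA`, `tB`) of a
range of positions. -/
structure Key where
  sA : ℕ
  tA : ℕ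
  sB : ℕ
  tB : ℕ

/-- States are ordered and at most `2`. -/
def Key.Valid (κ : Key) : Prop := κ.sA ≤ κ.tA ∧ κ.tA ≤ 2 ∧ κ.sB ≤ κ.tB ∧ κ.tB ≤ 2

/-- `u` and `v` are intermediate states of the two intervals. -/
def Key.Mid (κ : Key) (u v : ℕ) : Prop := κ.sA ≤ u ∧ u ≤ κ.tA ∧ κ.sB ≤ v ∧ v ≤ κ.tB

/-- Two intervals `[a₁, a₂)` and `[b₁, b₂)` together with their value. -/
structure Entry where
  val : ℝ
  a₁ : ℕ
  a₂ : ℕ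
  b₁ : ℕ
  b₂ : ℕ

/-- The sum of `W c α β` over the positions `c` from `l` to `r - 1`, where `α` and `β` tell whether
`c` is in `[a₁, a₂)` and in `[b₁, b₂)`. -/
noncomputable def total (W : ℕ → Bool → Bool → ℝ) (l r a₁ a₂ b₁ b₂ : ℕ) : ℝ :=
  ∑ c ∈ Finset.Ico l r, W c (decide (a₁ ≤ c ∧ c < a₂)) (decide (b₁ ≤ c ∧ c < b₂))

/-- `e` is an optimal pair of intervals on the positions `l, …, r - 1` for the states `κ`. -/
def IsOpt (W : ℕ → Bool → Bool → ℝ) (l r : ℕ) (κ : Key) (e : Entry) : Prop :=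
  Segment l r κ.sA κ.tA e.a₁ e.a₂ ∧ Segment l r κ.sB κ.tB e.b₁ e.b₂ ∧
  e.val = total W l r e.a₁ e.a₂ e.b₁ e.b₂ ∧
  ∀ a₁ a₂ b₁ b₂, Segment l r κ.sA κ.tA a₁ a₂ → Segment l r κ.sB κ.tB b₁ b₂ →
    total W l r a₁ a₂ b₁ b₂ ≤ e.val

/-- `e` is a best one among the entries `C u v` for intermediate states `u`, `v`. -/
def BestOf (κ : Key) (C : ℕ → ℕ → Entry) (e : Entry) : Prop :=
  (∃ u v, κ.Mid u v ∧ e = C u v) ∧ ∀ u v, κ.Mid u v → (C u v).val ≤ e.val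

/-- The entry for a single position at which the intervals are in states `u` and `v`. -/
def Entry.single (x : ℝ) (c u v : ℕ) : Entry where
  val := x
  a₁ := if 1 ≤ u then c else c + 1
  a₂ := if 2 ≤ u then c else c + 1
  b₁ := if 1 ≤ v then c else c + 1
  b₂ := if 2 ≤ v then c else c + 1

/-- Entries for two adjacent ranges are combined; at the border the intervals are in states `u` and
`v`. An end of an interval is taken from the left range if it has been passed at the border. -/
noncomputable def Entry.join (e f : Entry) (u v : ℕ) : Entry where
  val := e.val + f.val
  a₁ := if 1 ≤ u then e.a₁ else f.a₁
  a₂ := if 2 ≤ u then e.a₂ else f.a₂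
  b₁ := if 1 ≤ v then e.b₁ else f.b₁
  b₂ := if 2 ≤ v then e.b₂ else f.b₂

theorem total_congr {W W' : ℕ → Bool → Bool → ℝ} {l r a₁ a₂ b₁ b₂ a₁' a₂' b₁' b₂' : ℕ}
    (hW : ∀ c, l ≤ c → c < r → W c = W' c)
    (ha : ∀ c, l ≤ c → c < r → ((a₁ ≤ c ∧ c < a₂) ↔ (a₁' ≤ c ∧ c < a₂')))
    (hb : ∀ c, l ≤ c → c < r → ((b₁ ≤ c ∧ c < b₂) ↔ (b₁' ≤ c ∧ c < b₂'))) :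
    total W l r a₁ a₂ b₁ b₂ = total W' l r a₁' a₂' b₁' b₂' := by
  refine Finset.sum_congr rfl fun c hc => ?_
  rw [Finset.mem_Ico] at hc
  rw [hW c hc.1 hc.2, decide_eq_decide.2 (ha c hc.1 hc.2), decide_eq_decide.2 (hb c hc.1 hc.2)]

theorem total_split (W : ℕ → Bool → Bool → ℝ) {l m r : ℕ} (a₁ a₂ b₁ b₂ : ℕ) (hlm : l ≤ m)
    (hmr : m ≤ r) :
    total W l r a₁ a₂ b₁ b₂ = total W l m a₁ a₂ b₁ b₂ + total W m r a₁ a₂ b₁ b₂ :=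
  (Finset.sum_Ico_consecutive _ hlm hmr).symm

theorem IsOpt.congr {W W' : ℕ → Bool → Bool → ℝ} {l r : ℕ} {κ : Key} {e : Entry}
    (hW : ∀ c, l ≤ c → c < r → W c = W' c) (h : IsOpt W l r κ e) : IsOpt W' l r κ e := by
  have H : ∀ a₁ a₂ b₁ b₂, total W l r a₁ a₂ b₁ b₂ = total W' l r a₁ a₂ b₁ b₂ :=
    fun _ _ _ _ => total_congr hW (fun _ _ _ => Iff.rfl) (fun _ _ _ => Iff.rfl)
  obtain ⟨h₁, h₂, h₃, h₄⟩ := h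
  simp only [H] at h₃ h₄
  exact ⟨h₁, h₂, h₃, h₄⟩

theorem isOpt_single {W : ℕ → Bool → Bool → ℝ} {c : ℕ} {κ : Key} {e : Entry} (hκ : κ.Valid)
    (h : BestOf κ (fun u v => .single (W c (decide (u = 1)) (decide (v = 1))) c u v) e) :
    IsOpt W c (c + 1) κ e := by
  have key : ∀ u v, κ.Mid u v → total W c (c + 1) (if 1 ≤ u then c else c + 1)
      (if 2 ≤ u then c else c + 1) (if 1 ≤ v then c else c + 1) (if 2 ≤ v then c else c + 1)
      = W c (decide (u = 1)) (decide (v = 1)) := by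
    rintro u v ⟨h₁, h₂, h₃, h₄⟩
    have hu : u ≤ 2 := h₂.trans hκ.2.1
    have hv : v ≤ 2 := h₄.trans hκ.2.2.2
    rw [total, Nat.Ico_succ_singleton, Finset.sum_singleton]
    congr 1
    · rw [decide_eq_decide]; split_ifs <;> omega
    · rw [decide_eq_decide]; split_ifs <;> omega
  obtain ⟨⟨u, v, huv, rfl⟩, hmax⟩ := h
  refine ⟨(segment_succ_iff hκ.1 hκ.2.1).2 ⟨u, huv.1, huv.2.1, rfl, rfl⟩,
    (segment_succ_iff hκ.2.2.1 hκ.2.2.2).2 ⟨v, huv.2.2.1, huv.2.2.2, rfl, rfl⟩,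
    (key u v huv).symm, ?_⟩
  intro a₁ a₂ b₁ b₂ ha hb
  obtain ⟨u', h₁, h₂, rfl, rfl⟩ := (segment_succ_iff hκ.1 hκ.2.1).1 ha
  obtain ⟨v', h₃, h₄, rfl, rfl⟩ := (segment_succ_iff hκ.2.2.1 hκ.2.2.2).1 hb
  rw [key u' v' ⟨h₁, h₂, h₃, h₄⟩]
  exact hmax u' v' ⟨h₁, h₂, h₃, h₄⟩

theorem isOpt_join {W : ℕ → Bool → Bool → ℝ} {l m r : ℕ} (hlm : l < m) (hmr : m < r) {κ : Key}
    (hκ : κ.Valid) {L R : Key → Entry} (hL : ∀ κ : Key, κ.Valid → IsOpt W l m κ (L κ))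
    (hR : ∀ κ : Key, κ.Valid → IsOpt W m r κ (R κ)) {e : Entry}
    (h : BestOf κ (fun u v => (L ⟨κ.sA, u, κ.sB, v⟩).join (R ⟨u, κ.tA, v, κ.tB⟩) u v) e) :
    IsOpt W l r κ e := by
  obtain ⟨k₁, k₂, k₃, k₄⟩ := hκ
  obtain ⟨⟨u, v, ⟨h₁, h₂, h₃, h₄⟩, rfl⟩, hmax⟩ := h
  obtain ⟨lA, lB, lv, -⟩ := hL ⟨κ.sA, u, κ.sB, v⟩ ⟨h₁, h₂.trans k₂, h₃, h₄.trans k₄⟩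
  obtain ⟨rA, rB, rv, -⟩ := hR ⟨u, κ.tA, v, κ.tB⟩ ⟨h₂, k₂, h₄, k₄⟩
  refine ⟨Segment.join hlm hmr h₁ h₂ lA rA, Segment.join hlm hmr h₃ h₄ lB rB, ?_, ?_⟩
  · rw [total_split W _ _ _ _ hlm.le hmr.le]
    simp only [Entry.join]
    rw [lv, rv]
    congr 1
    · exact total_congr (fun _ _ _ => rfl) (fun c _ hc => (lA.join_mem_left rA hc).symm)
        (fun c _ hc => (lB.join_mem_left rB hc).symm)
    · exact total_congr (fun _ _ _ => rfl) (fun c hc hc' => (lA.join_mem_right rA hc hc').symm)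
        (fun c hc hc' => (lB.join_mem_right rB hc hc').symm)
  · intro a₁ a₂ b₁ b₂ ha hb
    obtain ⟨u', i₁, i₂, lA', rA'⟩ := ha.split hlm hmr k₂ k₁
    obtain ⟨v', i₃, i₄, lB', rB'⟩ := hb.split hlm hmr k₄ k₃
    refine le_trans ?_ (hmax u' v' ⟨i₁, i₂, i₃, i₄⟩)
    rw [total_split W _ _ _ _ hlm.le hmr.le]
    refine add_le_add ?_ ?_
    · refine le_trans (le_of_eq ?_)
        ((hL ⟨κ.sA, u', κ.sB, v'⟩ ⟨i₁, i₂.trans k₂, i₃, i₄.trans k₄⟩).2.2.2 _ _ _ _ lA' lB')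
      exact total_congr (fun _ _ _ => rfl) (fun c _ hc => by omega) (fun c _ hc => by omega)
    · refine le_trans (le_of_eq ?_)
        ((hR ⟨u', κ.tA, v', κ.tB⟩ ⟨i₂, k₂, i₄, k₄⟩).2.2.2 _ _ _ _ rA' rB')
      exact total_congr (fun _ _ _ => rfl) (fun c _ hc => by omega) (fun c _ hc => by omega)

end TwoBoxes

/-! ### The nodes of the segment tree -/

namespace TwoBoxes

open RealRAM

/-- The number of a key in the memory layout. -/
def Key.code (κ : Key) : ℕ := ((κ.sA * 3 + κ.tA) * 3 + κ.sB) * 3 + κ.tB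

theorem Key.code_injOn {κ κ' : Key} (h : κ.Valid) (h' : κ'.Valid) (hc : κ.code = κ'.code) :
    κ = κ' := by
  obtain ⟨a, b, c, d⟩ := κ
  obtain ⟨a', b', c', d'⟩ := κ'
  simp only [Key.Valid, Key.code] at h h' hc
  simp only [Key.mk.injEq]
  omega

/-- The entry of the node `v` of the tree for the states `κ`. The arrays with numbers from `100` on
are those of the tree. -/
def entry (σ : State) (κ : Key) (v : ℕ) : Entry where
  val := σ.real (100 + κ.code) v
  a₁ := σ.word (100 + 4 * κ.code) v
  a₂ := σ.word (101 + 4 * κ.code) v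
  b₁ := σ.word (102 + 4 * κ.code) v
  b₂ := σ.word (103 + 4 * κ.code) v

/-- Expressions that compute an entry. -/
structure EntryExpr where
  val : RExpr
  a₁ : WExpr
  a₂ : WExpr
  b₁ : WExpr
  b₂ : WExpr

/-- The value. -/
noncomputable def EntryExpr.eval (C : EntryExpr) (σ : State) : Entry where
  val := C.val.eval σ
  a₁ := C.a₁.eval σ
  a₂ := C.a₂.eval σ
  b₁ := C.b₁.eval σ
  b₂ := C.b₂.eval σ

/-- All expressions can be evaluated. -/
def EntryExpr.Ok (C : EntryExpr) (N : ℕ) (σ : State) : Prop :=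
  C.val.Ok N σ ∧ C.a₁.Ok N σ ∧ C.a₂.Ok N σ ∧ C.b₁.Ok N σ ∧ C.b₂.Ok N σ

/-- The states differ at most in the entries of the node `v`. -/
def AgreeOff (v : ℕ) (σ τ : State) : Prop :=
  (∀ a < 100, τ.word a = σ.word a) ∧ (∀ a < 100, τ.real a = σ.real a) ∧
  ∀ a i, i ≠ v → τ.word a i = σ.word a i ∧ τ.real a i = σ.real a i

theorem AgreeOff.refl (v : ℕ) (σ : State) : AgreeOff v σ σ :=
  ⟨fun _ _ => rfl, fun _ _ => rfl, fun _ _ _ => ⟨rfl, rfl⟩⟩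

theorem AgreeOff.trans {v : ℕ} {σ τ υ : State} (h : AgreeOff v σ τ) (h' : AgreeOff v τ υ) :
    AgreeOff v σ υ :=
  ⟨fun a ha => (h'.1 a ha).trans (h.1 a ha), fun a ha => (h'.2.1 a ha).trans (h.2.1 a ha),
    fun a i hi => ⟨(h'.2.2 a i hi).1.trans (h.2.2 a i hi).1,
      (h'.2.2 a i hi).2.trans (h.2.2 a i hi).2⟩⟩

theorem AgreeOff.setWord {v : ℕ} {σ τ : State} (h : AgreeOff v σ τ) {a : ℕ} (ha : 100 ≤ a)
    (x : ℕ) : AgreeOff v σ (τ.setWord a v x) := by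
  refine ⟨fun b hb => ?_, h.2.1, fun b i hi => ⟨?_, (h.2.2 b i hi).2⟩⟩
  · rw [State.word_setWord_of_ne _ _ _ (by omega), h.1 b hb]
  · rw [State.word_setWord, if_neg (fun h => hi h.2), (h.2.2 b i hi).1]

theorem AgreeOff.setReal {v : ℕ} {σ τ : State} (h : AgreeOff v σ τ) {a : ℕ} (ha : 100 ≤ a)
    (x : ℝ) : AgreeOff v σ (τ.setReal a v x) := by
  refine ⟨h.1, fun b hb => ?_, fun b i hi => ⟨(h.2.2 b i hi).1, ?_⟩⟩
  · rw [State.real_setReal_of_ne _ _ _ (by omega), h.2.1 b hb]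
  · rw [State.real_setReal, if_neg (fun h => hi h.2), (h.2.2 b i hi).2]

theorem AgreeOff.entry_eq {v v' : ℕ} {σ τ : State} (h : AgreeOff v σ τ) (hv : v' ≠ v) (κ : Key) :
    entry τ κ v' = entry σ κ v' := by
  simp only [entry, h.2.2 _ v' hv]

/-- The expressions can be evaluated, with the same result, while the entries of the node `v` are
being overwritten. -/
def EntryExpr.Stable (C : EntryExpr) (N v : ℕ) (σ : State) : Prop :=
  ∀ τ, AgreeOff v σ τ → C.Ok N τ ∧ C.eval τ = C.eval σ

theorem EntryExpr.Stable.of_agreeOff {C : EntryExpr} {N v : ℕ} {σ τ : State}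
    (h : C.Stable N v σ) (h' : AgreeOff v σ τ) : C.Stable N v τ := fun υ hυ =>
  ⟨(h υ (h'.trans hυ)).1, ((h υ (h'.trans hυ)).2).trans (h τ h').2.symm⟩

/-- Write the value of `C` into the entry for `κ` of the node given by the word variable `8`. -/
def store (κ : Key) (C : EntryExpr) : Program :=
  .seq (.setReal (100 + κ.code) (.var 8) C.val)
    (.seq (.setWord (100 + 4 * κ.code) (.var 8) C.a₁)
      (.seq (.setWord (101 + 4 * κ.code) (.var 8) C.a₂)
        (.seq (.setWord (102 + 4 * κ.code) (.var 8) C.b₁)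
          (.setWord (103 + 4 * κ.code) (.var 8) C.b₂))))

theorem store_wp {κ : Key} {C : EntryExpr} {N v : ℕ} {σ : State} {Q : State → Prop} (hvN : v < N)
    (hv : σ.word 8 0 = v) (hC : C.Stable N v σ)
    (hQ : ∀ τ, AgreeOff v σ τ → (∀ κ', κ'.code ≠ κ.code → entry τ κ' v = entry σ κ' v) →
      entry τ κ v = C.eval σ → Q τ) : (store κ C).wp N Q σ := by
  have hN : 0 < N := by omega
  have v8 : ∀ τ, AgreeOff v σ τ → τ.word 8 0 = v := fun τ h => by rw [h.1 8 (by omega), hv]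
  have A₀ := AgreeOff.refl v σ
  have A₁ := A₀.setReal (a := 100 + κ.code) (by omega) (C.val.eval σ)
  have A₂ := A₁.setWord (a := 100 + 4 * κ.code) (by omega) (C.a₁.eval σ)
  have A₃ := A₂.setWord (a := 101 + 4 * κ.code) (by omega) (C.a₂.eval σ)
  have A₄ := A₃.setWord (a := 102 + 4 * κ.code) (by omega) (C.b₁.eval σ)
  have A₅ := A₄.setWord (a := 103 + 4 * κ.code) (by omega) (C.b₂.eval σ)
  have e₁ : C.a₁.eval _ = C.a₁.eval σ := congrArg Entry.a₁ (hC _ A₁).2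
  have e₂ : C.a₂.eval _ = C.a₂.eval σ := congrArg Entry.a₂ (hC _ A₂).2
  have e₃ : C.b₁.eval _ = C.b₁.eval σ := congrArg Entry.b₁ (hC _ A₃).2
  have e₄ : C.b₂.eval _ = C.b₂.eval σ := congrArg Entry.b₂ (hC _ A₄).2
  have vv : ∀ τ, AgreeOff v σ τ → (WExpr.var 8).eval τ = v := v8
  have vN : ∀ τ, AgreeOff v σ τ → (WExpr.var 8).Ok N τ := fun τ h => ⟨hN, hN⟩
  simp only [store, Program.wp]
  refine ⟨vN _ A₀, by rw [vv _ A₀]; exact hvN, (hC _ A₀).1.1, ?_⟩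
  rw [vv _ A₀, vv _ A₁]
  refine ⟨vN _ A₁, hvN, (hC _ A₁).1.2.1, ?_⟩
  rw [e₁, vv _ A₂]
  refine ⟨vN _ A₂, hvN, (hC _ A₂).1.2.2.1, ?_⟩
  rw [e₂, vv _ A₃]
  refine ⟨vN _ A₃, hvN, (hC _ A₃).1.2.2.2.1, ?_⟩
  rw [e₃, vv _ A₄]
  refine ⟨vN _ A₄, hvN, (hC _ A₄).1.2.2.2.2, ?_⟩
  rw [e₄]
  refine hQ _ A₅ ?_ ?_
  · intro κ' hκ
    simp only [entry, State.word_setWord, State.real_setWord, State.real_setReal,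
      State.word_setReal, Entry.mk.injEq]
    refine ⟨?_, ?_, ?_, ?_, ?_⟩ <;> repeat' (rw [if_neg (by omega)])
  · simp [entry, EntryExpr.eval]

/-- Replace the entry for `κ` by the value of `C` if this is better. -/
def improve (κ : Key) (C : EntryExpr) : Program :=
  .branch (.realLt (.cell (100 + κ.code) (.var 8)) C.val) (store κ C) .nop

/-- Replace the entry for `κ` by the best of the values of several expressions. -/
def improveAll (κ : Key) (cs : List EntryExpr) : Program :=
  cs.foldr (fun C P => .seq (improve κ C) P) .nop

theorem improveAll_wp {κ : Key} {cs : List EntryExpr} {N v : ℕ} {σ : State} {Q : State → Prop}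
    (hvN : v < N) (hv : σ.word 8 0 = v) (hC : ∀ C ∈ cs, C.Stable N v σ)
    (hQ : ∀ τ, AgreeOff v σ τ → (∀ κ', κ'.code ≠ κ.code → entry τ κ' v = entry σ κ' v) →
      (entry τ κ v = entry σ κ v ∨ ∃ C ∈ cs, entry τ κ v = C.eval σ) →
      (entry σ κ v).val ≤ (entry τ κ v).val →
      (∀ C ∈ cs, (C.eval σ).val ≤ (entry τ κ v).val) → Q τ) :
    (improveAll κ cs).wp N Q σ := by
  induction cs generalizing σ with
  | nil =>
    exact hQ σ (.refl v σ) (fun _ _ => rfl) (Or.inl rfl) le_rfl (by simp)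
  | cons C cs ih =>
    have hN : 0 < N := by omega
    have hC₀ := hC C List.mem_cons_self
    have hCs : ∀ C ∈ cs, C.Stable N v σ := fun D hD => hC D (List.mem_cons_of_mem _ hD)
    have hval : (RExpr.cell (100 + κ.code) (.var 8)).eval σ = (entry σ κ v).val := by
      simp [entry, hv]
    refine ⟨⟨⟨⟨hN, hN⟩, ?_⟩, (hC₀ σ (.refl v σ)).1.1⟩, ?_, ?_⟩
    · change σ.word 8 0 < N
      rwa [hv]
    · intro hlt
      change (RExpr.cell (100 + κ.code) (.var 8)).eval σ < (C.eval σ).val at hlt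
      rw [hval] at hlt
      refine store_wp hvN hv hC₀ fun τ h₁ h₂ h₃ => ?_
      refine ih (by rw [h₁.1 8 (by omega), hv]) (fun D hD => (hCs D hD).of_agreeOff h₁)
        fun υ g₁ g₂ g₃ g₄ g₅ => ?_
      have hev : ∀ D ∈ cs, D.eval τ = D.eval σ := fun D hD => (hCs D hD τ h₁).2
      rw [h₃] at g₃ g₄
      refine hQ υ (h₁.trans g₁) (fun κ' hκ => (g₂ κ' hκ).trans (h₂ κ' hκ)) (Or.inr ?_)
        (hlt.le.trans g₄) ?_
      · rcases g₃ with g₃ | ⟨D, hD, g₃⟩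
        · exact ⟨C, List.mem_cons_self, g₃⟩
        · exact ⟨D, List.mem_cons_of_mem _ hD, by rw [g₃, hev D hD]⟩
      · intro D hD
        rcases List.mem_cons.1 hD with rfl | hD
        · exact g₄
        · rw [← hev D hD]
          exact g₅ D hD
    · intro hlt
      change ¬ (RExpr.cell (100 + κ.code) (.var 8)).eval σ < (C.eval σ).val at hlt
      rw [hval, not_lt] at hlt
      refine ih hv hCs fun υ g₁ g₂ g₃ g₄ g₅ => ?_
      refine hQ υ g₁ g₂ ?_ g₄ ?_
      · exact g₃.imp id fun ⟨D, hD, g₃⟩ => ⟨D, List.mem_cons_of_mem _ hD, g₃⟩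
      · intro D hD
        rcases List.mem_cons.1 hD with rfl | hD
        · exact hlt.trans g₄
        · exact g₅ D hD

/-- The pairs of intermediate states for `κ`. -/
def Key.mids (κ : Key) : List (ℕ × ℕ) :=
  (List.range' κ.sA (κ.tA + 1 - κ.sA)).flatMap fun u =>
    (List.range' κ.sB (κ.tB + 1 - κ.sB)).map fun v => (u, v)

theorem Key.mem_mids {κ : Key} {u v : ℕ} : (u, v) ∈ κ.mids ↔ κ.Mid u v := by
  simp only [Key.mids, List.mem_flatMap, List.mem_map, List.mem_range'_1, Key.Mid, Prod.mk.injEq]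
  constructor
  · rintro ⟨_, h₁, _, h₂, rfl, rfl⟩
    omega
  · intro h
    exact ⟨u, by omega, v, by omega, rfl, rfl⟩

/-- Write the best of the values of `C u v` for intermediate states `u`, `v` into the entry for
`κ`. -/
def storeBest (κ : Key) (C : ℕ → ℕ → EntryExpr) : Program :=
  .seq (store κ (C κ.sA κ.sB)) (improveAll κ (κ.mids.map fun q => C q.1 q.2))

theorem storeBest_wp {κ : Key} (hκ : κ.Valid) {C : ℕ → ℕ → EntryExpr} {N v : ℕ} {σ : State}
    {Q : State → Prop} (hvN : v < N) (hv : σ.word 8 0 = v)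
    (hC : ∀ a b, κ.Mid a b → (C a b).Stable N v σ)
    (hQ : ∀ τ, AgreeOff v σ τ → (∀ κ', κ'.code ≠ κ.code → entry τ κ' v = entry σ κ' v) →
      BestOf κ (fun a b => (C a b).eval σ) (entry τ κ v) → Q τ) :
    (storeBest κ C).wp N Q σ := by
  have h₀ : κ.Mid κ.sA κ.sB := ⟨le_rfl, hκ.1, le_rfl, hκ.2.2.1⟩
  refine store_wp hvN hv (hC _ _ h₀) fun τ h₁ h₂ h₃ => ?_
  refine improveAll_wp hvN (by rw [h₁.1 8 (by omega), hv]) ?_ fun υ g₁ g₂ g₃ g₄ g₅ => ?_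
  · intro D hD
    obtain ⟨q, hq, rfl⟩ := List.mem_map.1 hD
    exact (hC _ _ (Key.mem_mids.1 hq)).of_agreeOff h₁
  · refine hQ υ (h₁.trans g₁) (fun κ' hκ => (g₂ κ' hκ).trans (h₂ κ' hκ)) ⟨?_, ?_⟩
    · rcases g₃ with g₃ | ⟨D, hD, g₃⟩
      · exact ⟨_, _, h₀, by rw [g₃, h₃]⟩
      · obtain ⟨q, hq, rfl⟩ := List.mem_map.1 hD
        have hq' := Key.mem_mids.1 hq
        exact ⟨_, _, hq', by rw [g₃, (hC _ _ hq' τ h₁).2]⟩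
    · intro a b hab
      change ((C a b).eval σ).val ≤ _
      rw [← (hC a b hab τ h₁).2]
      exact g₅ _ (List.mem_map.2 ⟨(a, b), Key.mem_mids.2 hab, rfl⟩)

/-- Compute the entries for all keys of a list. -/
def storeAll (ks : List Key) (C : Key → ℕ → ℕ → EntryExpr) : Program :=
  ks.foldr (fun κ P => .seq (storeBest κ (C κ)) P) .nop

theorem storeAll_wp {ks : List Key} (hks : ∀ κ ∈ ks, κ.Valid) {C : Key → ℕ → ℕ → EntryExpr}
    {N v : ℕ} {σ : State} {Q : State → Prop} (hvN : v < N) (hv : σ.word 8 0 = v)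
    (hC : ∀ κ ∈ ks, ∀ a b, κ.Mid a b → (C κ a b).Stable N v σ)
    (hQ : ∀ τ, AgreeOff v σ τ →
      (∀ κ', (∀ κ ∈ ks, κ'.code ≠ κ.code) → entry τ κ' v = entry σ κ' v) →
      (∀ κ ∈ ks, BestOf κ (fun a b => (C κ a b).eval σ) (entry τ κ v)) → Q τ) :
    (storeAll ks C).wp N Q σ := by
  induction ks generalizing σ with
  | nil => exact hQ σ (.refl v σ) (fun _ _ => rfl) (by simp)
  | cons κ ks ih =>
    have hκ := hks κ List.mem_cons_self
    have hks' : ∀ κ ∈ ks, κ.Valid := fun κ' h => hks κ' (List.mem_cons_of_mem _ h)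
    have hC' := fun κ' (h : κ' ∈ ks) => hC κ' (List.mem_cons_of_mem _ h)
    refine storeBest_wp hκ hvN hv (hC κ List.mem_cons_self) fun τ h₁ h₂ h₃ => ?_
    refine ih hks' (by rw [h₁.1 8 (by omega), hv])
      (fun κ' h a b hab => (hC' κ' h a b hab).of_agreeOff h₁) fun υ g₁ g₂ g₃ => ?_
    have hev : ∀ κ' ∈ ks, BestOf κ' (fun a b => (C κ' a b).eval σ) (entry υ κ' v) := by
      intro κ' h
      obtain ⟨⟨a, b, hab, he⟩, hm⟩ := g₃ κ' h
      refine ⟨⟨a, b, hab, he.trans (hC' κ' h a b hab τ h₁).2⟩, fun a b hab => ?_⟩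
      change ((C κ' a b).eval σ).val ≤ _
      rw [← (hC' κ' h a b hab τ h₁).2]
      exact hm a b hab
    refine hQ υ (h₁.trans g₁) ?_ ?_
    · intro κ' h
      rw [g₂ κ' fun κ'' h'' => h κ'' (List.mem_cons_of_mem _ h''), h₂ κ' (h κ List.mem_cons_self)]
    · intro κ' h
      rcases List.mem_cons.1 h with rfl | h
      · by_cases hin : κ' ∈ ks
        · exact hev κ' hin
        · rw [g₂ κ' fun κ'' h'' hc => hin (by
            rwa [Key.code_injOn hκ (hks' κ'' h'') hc])]
          exact h₃
      · exact hev κ' h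

/-- All valid keys. -/
def allKeys : List Key :=
  (List.range 3).flatMap fun tA => (List.range (tA + 1)).flatMap fun sA =>
    (List.range 3).flatMap fun tB => (List.range (tB + 1)).map fun sB => ⟨sA, tA, sB, tB⟩

theorem mem_allKeys {κ : Key} : κ ∈ allKeys ↔ κ.Valid := by
  obtain ⟨sA, tA, sB, tB⟩ := κ
  simp only [allKeys, List.mem_flatMap, List.mem_range, List.mem_map, Key.mk.injEq, Key.Valid]
  constructor
  · rintro ⟨_, h₁, _, h₂, _, h₃, _, h₄, rfl, rfl, rfl, rfl⟩
    omega
  · intro h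
    exact ⟨tA, by omega, sA, by omega, tB, by omega, sB, by omega, rfl, rfl, rfl, rfl⟩

/-- The entry of an inner node for the border states `u`, `v`; the children of the node `x` are the
nodes `2 * x` and `2 * x + 1`. -/
def joinExpr (κ : Key) (u v : ℕ) : EntryExpr :=
  let L := Key.code ⟨κ.sA, u, κ.sB, v⟩
  let R := Key.code ⟨u, κ.tA, v, κ.tB⟩
  let l : WExpr := .mul (.const 2) (.var 8)
  let r : WExpr := .add (.mul (.const 2) (.var 8)) (.const 1)
  { val := .add (.cell (100 + L) l) (.cell (100 + R) r)
    a₁ := if 1 ≤ u then .cell (100 + 4 * L) l else .cell (100 + 4 * R) r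
    a₂ := if 2 ≤ u then .cell (101 + 4 * L) l else .cell (101 + 4 * R) r
    b₁ := if 1 ≤ v then .cell (102 + 4 * L) l else .cell (102 + 4 * R) r
    b₂ := if 2 ≤ v then .cell (103 + 4 * L) l else .cell (103 + 4 * R) r }

theorem joinExpr_eval {κ : Key} {u v x : ℕ} {σ : State} (h : σ.word 8 0 = x) :
    (joinExpr κ u v).eval σ = (entry σ ⟨κ.sA, u, κ.sB, v⟩ (2 * x)).join
      (entry σ ⟨u, κ.tA, v, κ.tB⟩ (2 * x + 1)) u v := by
  simp only [joinExpr, EntryExpr.eval, Entry.join, entry, apply_ite (WExpr.eval σ),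
    WExpr.eval, RExpr.eval, h]

theorem joinExpr_ok {κ : Key} {u v x N : ℕ} {σ : State} (h : σ.word 8 0 = x)
    (hN : 2 * x + 2 < N) : (joinExpr κ u v).Ok N σ := by
  simp only [joinExpr, EntryExpr.Ok, apply_ite (WExpr.Ok N σ), WExpr.eval, RExpr.Ok, WExpr.Ok, h]
  split_ifs <;> omega

/-- The weights that a position contributes when it is in the first interval only, in the second
interval only, or in both are kept in the cells `1`, `2`, `3` of the real array `7`. -/
def singleExpr (u v : ℕ) : EntryExpr where
  val := if u = 1 then (if v = 1 then .cell 7 (.const 3) else .cell 7 (.const 1))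
    else if v = 1 then .cell 7 (.const 2) else .const 0
  a₁ := if 1 ≤ u then .var 8 else .add (.var 8) (.const 1)
  a₂ := if 2 ≤ u then .var 8 else .add (.var 8) (.const 1)
  b₁ := if 1 ≤ v then .var 8 else .add (.var 8) (.const 1)
  b₂ := if 2 ≤ v then .var 8 else .add (.var 8) (.const 1)

theorem singleExpr_eval {u v x : ℕ} {σ : State} (h : σ.word 8 0 = x) :
    (singleExpr u v).eval σ = .single (if u = 1 then (if v = 1 then σ.real 7 3 else σ.real 7 1)
      else if v = 1 then σ.real 7 2 else 0) x u v := by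
  simp only [singleExpr, EntryExpr.eval, Entry.single, apply_ite (WExpr.eval σ),
    apply_ite (RExpr.eval σ), WExpr.eval, RExpr.eval, h, Rat.cast_zero]

theorem singleExpr_ok {u v x N : ℕ} {σ : State} (h : σ.word 8 0 = x)
    (hN : x + 5 < N) : (singleExpr u v).Ok N σ := by
  simp only [singleExpr, EntryExpr.Ok, apply_ite (WExpr.Ok N σ), apply_ite (RExpr.Ok N σ),
    WExpr.eval, RExpr.Ok, WExpr.Ok, h]
  split_ifs <;> simp <;> omega

/-- What the main part of the program reads but does not change: the number `n` of points, the
number `m` of leaves of the tree, and, for the point with abscissa of rank `c`, the rank `yr c` of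
its ordinate and its weight `w c`; moreover `xr r` is the rank of the abscissa of the point with
ordinate of rank `r`, and `X`, `Y` are the sorted abscissae and ordinates. -/
structure Data where
  n : ℕ
  m : ℕ
  yr : ℕ → ℕ
  xr : ℕ → ℕ
  w : ℕ → ℝ
  X : ℕ → ℝ
  Y : ℕ → ℝ

/-- The memory holds the data `D`. -/
structure Data.Holds (D : Data) (σ : State) : Prop where
  n : σ.word 0 0 = D.n
  m : σ.word 1 0 = D.m
  yr : σ.word 2 = D.yr
  xr : σ.word 3 = D.xr
  X : σ.real 4 = D.X
  Y : σ.real 5 = D.Y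
  w : σ.real 6 = D.w

/-- The weight of leaf `c` when the ordinates of the two boxes range over the ranks in `[i, j)` and
in `[k, l)`, and `α`, `β` tell whether the abscissa is in the two boxes. The leaves are the nodes
`m, …, 2 * m - 1`, so the rank of the abscissa is `c - m`. -/
noncomputable def Data.weight (D : Data) (i j k l c : ℕ) (α β : Bool) : ℝ :=
  if xor (α && decide (i ≤ D.yr (c - D.m) ∧ D.yr (c - D.m) < j))
    (β && decide (k ≤ D.yr (c - D.m) ∧ D.yr (c - D.m) < l)) then D.w (c - D.m) else 0

/-- The weights for the values of `i`, `j`, `k`, `l` in the memory. -/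
noncomputable def Data.weightAt (D : Data) (σ : State) : ℕ → Bool → Bool → ℝ :=
  D.weight (σ.word 4 0) (σ.word 5 0) (σ.word 6 0) (σ.word 7 0)

/-- Test whether the ordinate of the leaf given by the word variable `8` has a rank from the value
of the variable `a` up to, but excluding, the value of the variable `b`. -/
def rankTest (a b : ℕ) : Test :=
  .conj (.neg (.wordLt (.cell 2 (.sub (.var 8) (.var 1))) (.var a)))
    (.wordLt (.cell 2 (.sub (.var 8) (.var 1))) (.var b))

/-- The weight of the leaf given by the word variable `8`. -/
def leafWeightExpr : RExpr := .cell 6 (.sub (.var 8) (.var 1))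

/-- Write three numbers into the cells `1`, `2`, `3` of the real array `7`. -/
def setTemps (e₁ e₂ e₃ : RExpr) : Program :=
  .seq (.setReal 7 (.const 1) e₁) (.seq (.setReal 7 (.const 2) e₂) (.setReal 7 (.const 3) e₃))

/-- Compute the weights of a leaf. -/
def leafWeights : Program :=
  .branch (rankTest 4 5)
    (.branch (rankTest 6 7) (setTemps leafWeightExpr leafWeightExpr (.const 0))
      (setTemps leafWeightExpr (.const 0) leafWeightExpr))
    (.branch (rankTest 6 7) (setTemps (.const 0) leafWeightExpr leafWeightExpr)
      (setTemps (.const 0) (.const 0) (.const 0)))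

/-- Recompute all entries of the node given by the word variable `8`. -/
def computeNode : Program :=
  .branch (.wordLt (.var 8) (.var 1)) (storeAll allKeys joinExpr)
    (.seq leafWeights (storeAll allKeys fun _ => singleExpr))

theorem leafWeights_wp {D : Data} {N v : ℕ} {σ : State} {Q : State → Prop} (hD : D.Holds σ)
    (hv : σ.word 8 0 = v) (hN : v + 5 < N)
    (hQ : ∀ τ, τ.word = σ.word → (∀ a, a ≠ 7 → τ.real a = σ.real a) →
      (∀ α β, D.weightAt σ v α β = if α then (if β then τ.real 7 3 else τ.real 7 1)
        else if β then τ.real 7 2 else 0) → Q τ) : leafWeights.wp N Q σ := by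
  have hm : σ.word 1 0 = D.m := hD.m
  have hNs : v - D.m < N := by omega
  have h0 : 0 < N := by omega
  have h1 : 1 < N := by omega
  have h2 : 2 < N := by omega
  have h3 : 3 < N := by omega
  have key : ∀ (x y z : ℝ), (∀ α β, D.weightAt σ v α β = if α then (if β then z else x)
        else if β then y else 0) → Q (((σ.setReal 7 1 x).setReal 7 2 y).setReal 7 3 z) := by
    intro x y z h
    refine hQ _ rfl (fun a ha => ?_) (fun α β => ?_)
    · rw [State.real_setReal_of_ne _ _ _ ha, State.real_setReal_of_ne _ _ _ ha,
        State.real_setReal_of_ne _ _ _ ha]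
    · simpa using h α β
  simp only [leafWeights, rankTest, setTemps, leafWeightExpr, Program.wp, Test.Ok, Test.Holds,
    WExpr.Ok, WExpr.eval, RExpr.Ok, RExpr.eval, State.word_setReal, State.real_setReal, hv, hm, hNs,
    h0, h1, h2, h3, hD.yr, hD.w, and_self, true_and, not_lt, not_and, Rat.cast_zero]
  simp only [Data.weightAt, Data.weight] at key
  refine ⟨fun hA => ⟨fun hB => ?_, fun hB => ?_⟩, fun hA => ⟨fun hB => ?_, fun hB => ?_⟩⟩ <;>
    refine key _ _ _ fun α β => ?_ <;> cases α <;> cases β <;> simp [hA, hB] <;> grind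

end TwoBoxes

/-! ### Building and updating the segment tree -/

namespace TwoBoxes

open RealRAM

/-- The variables, i.e. the arrays outside of the tree, have the same values, except for the current
node and the temporary weights. -/
def SameVars (σ τ : State) : Prop :=
  (∀ a < 100, a ≠ 8 → τ.word a = σ.word a) ∧ (∀ a < 100, a ≠ 7 → τ.real a = σ.real a)

theorem SameVars.refl (σ : State) : SameVars σ σ := ⟨fun _ _ _ => rfl, fun _ _ _ => rfl⟩

theorem SameVars.trans {σ τ υ : State} (h : SameVars σ τ) (h' : SameVars τ υ) : SameVars σ υ :=
  ⟨fun a h₁ h₂ => (h'.1 a h₁ h₂).trans (h.1 a h₁ h₂),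
    fun a h₁ h₂ => (h'.2 a h₁ h₂).trans (h.2 a h₁ h₂)⟩

theorem SameVars.setNode (σ : State) (v : ℕ) : SameVars σ (σ.setWord 8 0 v) :=
  ⟨fun _ _ h => State.word_setWord_of_ne _ _ _ h, fun _ _ _ => rfl⟩

theorem SameVars.holds {D : Data} {σ τ : State} (h : SameVars σ τ) (hD : D.Holds σ) :
    D.Holds τ where
  n := by rw [h.1 0 (by omega) (by omega), hD.n]
  m := by rw [h.1 1 (by omega) (by omega), hD.m]
  yr := by rw [h.1 2 (by omega) (by omega), hD.yr]
  xr := by rw [h.1 3 (by omega) (by omega), hD.xr]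
  X := by rw [h.2 4 (by omega) (by omega), hD.X]
  Y := by rw [h.2 5 (by omega) (by omega), hD.Y]
  w := by rw [h.2 6 (by omega) (by omega), hD.w]

theorem SameVars.weightAt {σ τ : State} (h : SameVars σ τ) (D : Data) :
    D.weightAt τ = D.weightAt σ := by
  simp only [Data.weightAt, h.1 4 (by omega) (by omega), h.1 5 (by omega) (by omega),
    h.1 6 (by omega) (by omega), h.1 7 (by omega) (by omega)]

/-- The entries of the node `v` are optimal for the weights `W`. The leaves are the nodes from
`2 ^ h` to `2 ^ (h + 1) - 1`, and the leaves below the node `v` are those from `v * 2 ^ e` to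
`(v + 1) * 2 ^ e - 1`, where `e` is the height of `v`. -/
def NodeOpt (W : ℕ → Bool → Bool → ℝ) (h : ℕ) (σ : State) (v : ℕ) : Prop :=
  ∀ e, 2 ^ h ≤ v * 2 ^ e → v * 2 ^ e < 2 ^ (h + 1) → ∀ κ : Key, κ.Valid →
    IsOpt W (v * 2 ^ e) (v * 2 ^ e + 2 ^ e) κ (entry σ κ v)

theorem NodeOpt.of_entry_eq {W : ℕ → Bool → Bool → ℝ} {h : ℕ} {σ τ : State} {v : ℕ}
    (H : NodeOpt W h σ v) (he : ∀ κ, entry τ κ v = entry σ κ v) : NodeOpt W h τ v :=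
  fun e h₁ h₂ κ hκ => by rw [he]; exact H e h₁ h₂ κ hκ

theorem add_one_mul_two_pow_le {v e h : ℕ} (hv : 1 ≤ v) (hlt : v * 2 ^ e < 2 ^ (h + 1)) :
    (v + 1) * 2 ^ e ≤ 2 ^ (h + 1) := by
  have he : e < h + 1 := by
    refine (Nat.pow_lt_pow_iff_right (a := 2) (by norm_num)).1 (lt_of_le_of_lt ?_ hlt)
    exact Nat.le_mul_of_pos_left _ hv
  have hsplit : 2 ^ (h + 1) = 2 ^ (h + 1 - e) * 2 ^ e := by
    rw [← pow_add]; congr 1; omega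
  rw [hsplit] at hlt ⊢
  exact Nat.mul_le_mul_right _ (Nat.lt_of_mul_lt_mul_right hlt)

theorem computeNode_wp {D : Data} {h N v : ℕ} {σ : State} {Q : State → Prop} (hD : D.Holds σ)
    (hm : D.m = 2 ^ h) (hN : 2 * D.m + 6 < N) (hv : σ.word 8 0 = v) (hv₁ : 1 ≤ v)
    (hv₂ : v < 2 * D.m)
    (hch : v < D.m → NodeOpt (D.weightAt σ) h σ (2 * v) ∧ NodeOpt (D.weightAt σ) h σ (2 * v + 1))
    (hQ : ∀ τ, SameVars σ τ → τ.word 8 = σ.word 8 →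
      (∀ κ v', v' ≠ v → entry τ κ v' = entry σ κ v') →
      NodeOpt (D.weightAt σ) h τ v → Q τ) : computeNode.wp N Q σ := by
  have hm' : σ.word 1 0 = D.m := hD.m
  refine ⟨⟨⟨show 0 < N by omega, show 0 < N by omega⟩, show 0 < N by omega,
    show 0 < N by omega⟩, fun hlt => ?_, fun hge => ?_⟩
  · simp only [Test.Holds, WExpr.eval, hv, hm'] at hlt
    obtain ⟨hl, hr⟩ := hch hlt
    refine storeAll_wp (fun κ hκ => mem_allKeys.1 hκ) (by omega) hv ?_ fun τ h₁ _ h₃ => ?_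
    · intro κ hκ a b hab τ hτ
      have hτv : τ.word 8 0 = v := by rw [hτ.1 8 (by omega), hv]
      refine ⟨joinExpr_ok hτv (by omega), ?_⟩
      rw [joinExpr_eval hτv, joinExpr_eval hv, hτ.entry_eq (by omega), hτ.entry_eq (by omega)]
    · refine hQ τ ⟨fun a ha _ => h₁.1 a ha, fun a ha _ => h₁.2.1 a ha⟩ (h₁.1 8 (by omega))
        (fun κ v' hv' => h₁.entry_eq hv' κ) ?_
      intro e he₁ he₂ κ hκ
      obtain ⟨e, rfl⟩ : ∃ e', e = e' + 1 := by
        refine Nat.exists_eq_succ_of_ne_zero ?_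
        rintro rfl
        omega
      have hle := add_one_mul_two_pow_le hv₁ he₂
      have hpos : 0 < 2 ^ e := by positivity
      have hpow : 2 ^ (e + 1) = 2 ^ e + 2 ^ e := by ring
      have hmul : v * 2 ^ (e + 1) = 2 * v * 2 ^ e := by ring
      have hmul' : (2 * v + 1) * 2 ^ e = v * 2 ^ (e + 1) + 2 ^ e := by ring
      rw [add_mul, one_mul] at hle
      refine isOpt_join (m := v * 2 ^ (e + 1) + 2 ^ e) (by omega) (by omega) hκ
        (L := fun κ => entry σ κ (2 * v)) (R := fun κ => entry σ κ (2 * v + 1)) ?_ ?_ ?_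
      · intro κ hκ
        have := hl e (by omega) (by omega) κ hκ
        rwa [← hmul] at this
      · intro κ hκ
        have := hr e (by omega) (by omega) κ hκ
        rwa [hmul', add_assoc, ← hpow] at this
      · have := h₃ κ (mem_allKeys.2 hκ)
        simpa only [joinExpr_eval hv] using this
  · simp only [Test.Holds, WExpr.eval, hv, hm'] at hge
    refine leafWeights_wp hD hv (by omega) fun σ' g₁ g₂ g₃ => ?_
    have hv' : σ'.word 8 0 = v := by rw [g₁, hv]
    refine storeAll_wp (fun κ hκ => mem_allKeys.1 hκ) (by omega) hv' ?_ fun τ h₁ _ h₃ => ?_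
    · intro κ hκ a b hab τ hτ
      have hτv : τ.word 8 0 = v := by rw [hτ.1 8 (by omega), hv']
      refine ⟨singleExpr_ok hτv (by omega), ?_⟩
      rw [singleExpr_eval hτv, singleExpr_eval hv', hτ.2.1 7 (by omega)]
    · refine hQ τ ⟨fun a ha _ => (h₁.1 a ha).trans (by rw [g₁]),
        fun a ha ha' => (h₁.2.1 a ha).trans (g₂ a ha')⟩ ((h₁.1 8 (by omega)).trans (by rw [g₁]))
        (fun κ v' hv' => (h₁.entry_eq hv' κ).trans ?_) ?_
      · simp only [entry, g₁, g₂ _ (show 100 + κ.code ≠ 7 by omega)]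
      · intro e he₁ he₂ κ hκ
        obtain rfl : e = 0 := by
          by_contra hne
          have h2 : 2 ^ 1 ≤ 2 ^ e := Nat.pow_le_pow_right (by norm_num) (by omega)
          have h3 : v * 2 ^ 1 ≤ v * 2 ^ e := Nat.mul_le_mul_left _ h2
          rw [pow_succ] at he₂
          omega
        rw [pow_zero, mul_one]
        refine isOpt_single hκ ?_
        have := h₃ κ (mem_allKeys.2 hκ)
        simp only [singleExpr_eval hv'] at this
        simpa only [g₃, decide_eq_true_eq] using this

-- Unification must not unfold the program text, which contains all entries of a node.
attribute [irreducible] computeNode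

/-- Compute all nodes, the children before their parents. -/
def buildTree : Program :=
  .seq (.assign 8 (.mul (.const 2) (.var 1)))
    (.loop (.wordLt (.const 1) (.var 8))
      (.seq (.assign 8 (.sub (.var 8) (.const 1))) computeNode))

theorem buildTree_runs : ∃ K, ∀ (D : Data) (h N : ℕ) (σ : State), D.Holds σ → D.m = 2 ^ h →
    2 * D.m + 6 < N → Runs N buildTree σ (K * D.m) fun τ => SameVars σ τ ∧
      ∀ v, 1 ≤ v → v < 2 * D.m → NodeOpt (D.weightAt σ) h τ v := by
  obtain ⟨K, hK⟩ := Runs.exists_cost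
    (.seq (.assign 8 (.sub (.var 8) (.const 1))) computeNode)
  refine ⟨10 + 2 * (10 + K), fun D h N σ₀ hD hm hN => ?_⟩
  have hpos : 0 < D.m := by rw [hm]; positivity
  have hm₀ : σ₀.word 1 0 = D.m := hD.m
  have h0 : 0 < N := by omega
  refine (Runs.seq (c := 6) (c' := (2 * D.m - 1) * (4 + K) + 4)
    ((Runs.of_wp ?_).mono (by simp [Program.maxCost, WExpr.cost])
      (Q := fun σ => σ = σ₀.setWord 8 0 (2 * D.m)) ?_)).mono ?_ (fun _ h => h)
  · simp only [Program.wp, WExpr.Ok, WExpr.eval, hm₀]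
    exact ⟨by omega, by omega, ⟨by omega, ⟨by omega, by omega⟩, by omega⟩, trivial⟩
  · rintro σ rfl
    refine (Runs.loop (b := .wordLt (.const 1) (.var 8)) (fun k τ => τ.word 8 0 = 2 * D.m - k ∧
      SameVars σ₀ τ ∧ ∀ v, 2 * D.m - k ≤ v → v < 2 * D.m → NodeOpt (D.weightAt σ₀) h τ v)
      (2 * D.m - 1) ?_ ?_ ?_).mono le_rfl ?_
    · rintro k τ hk ⟨h₁, h₂, h₃⟩
      simp only [Test.Ok, Test.Holds, WExpr.Ok, WExpr.eval, h₁]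
      refine ⟨by omega, by omega, ?_⟩
      refine hK _ _ _ ⟨show 0 < N from h0, show 0 < N from h0,
        ⟨⟨show 0 < N from h0, show 0 < N from h0⟩, show 1 < N by omega⟩, ?_⟩
      simp only [WExpr.eval, h₁]
      have s₁ := SameVars.setNode τ (2 * D.m - k - 1)
      have s₂ := h₂.trans s₁
      have hE : ∀ κ v, entry (τ.setWord 8 0 (2 * D.m - k - 1)) κ v = entry τ κ v := by
        intro κ v
        simp [entry, show ∀ x, ¬ 100 + x = 8 by omega, show ∀ x, ¬ 101 + x = 8 by omega,
          show ∀ x, ¬ 102 + x = 8 by omega, show ∀ x, ¬ 103 + x = 8 by omega]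
      refine computeNode_wp (v := 2 * D.m - k - 1) (s₂.holds hD) hm hN (by simp) (by omega)
        (by omega) ?_ ?_
      · intro hlt
        rw [s₂.weightAt]
        exact ⟨(h₃ _ (by omega) (by omega)).of_entry_eq fun κ => hE κ _,
          (h₃ _ (by omega) (by omega)).of_entry_eq fun κ => hE κ _⟩
      · rw [s₂.weightAt]
        intro υ g₁ g₂ g₃ g₄
        refine ⟨by rw [g₂]; simp; omega, s₂.trans g₁, fun v hv₁ hv₂ => ?_⟩
        by_cases hv : v = 2 * D.m - k - 1
        · rw [hv]; exact g₄
        · exact (h₃ v (by omega) hv₂).of_entry_eq fun κ => (g₃ κ v hv).trans (hE κ v)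
    · rintro τ ⟨h₁, -, -⟩
      simp only [Test.Ok, Test.Holds, WExpr.Ok, WExpr.eval, h₁]
      omega
    · exact ⟨by simp, SameVars.setNode _ _, fun v h₁ h₂ => by omega⟩
    · rintro τ ⟨-, h₂, h₃⟩
      exact ⟨h₂, fun v h₁ h₂ => h₃ v (by omega) h₂⟩
  · have e₁ : (2 * D.m - 1) * (4 + K) ≤ 2 * D.m * (10 + K) := Nat.mul_le_mul (by omega) (by omega)
    have e₂ : (10 + 2 * (10 + K)) * D.m = 10 * D.m + 2 * D.m * (10 + K) := by ring
    omega

/-- Recompute the node given by `e` and all nodes above it. -/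
def updateTree (e : WExpr) : Program :=
  .seq (.assign 8 e)
    (.loop (.wordLt (.const 0) (.var 8))
      (.seq computeNode (.assign 8 (.div (.var 8) (.const 2)))))

/-- If the weights of a single leaf have changed, then it suffices to recompute the nodes above
it. -/
theorem updateTree_runs (x : WExpr) : ∃ K, ∀ (D : Data) (h N c : ℕ) (σ : State)
    (W : ℕ → Bool → Bool → ℝ), D.Holds σ → D.m = 2 ^ h →
    2 * D.m + 6 < N → x.Ok N σ → x.eval σ = c → D.m ≤ c → c < 2 * D.m →
    (∀ c', D.m ≤ c' → c' < 2 * D.m → c' ≠ c → W c' = D.weightAt σ c') →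
    (∀ v, 1 ≤ v → v < 2 * D.m → NodeOpt W h σ v) →
    Runs N (updateTree x) σ (K * (h + 1)) fun τ => SameVars σ τ ∧
      ∀ v, 1 ≤ v → v < 2 * D.m → NodeOpt (D.weightAt σ) h τ v := by
  obtain ⟨K, hK⟩ := Runs.exists_cost
    (.seq computeNode (.assign 8 (.div (.var 8) (.const 2))))
  refine ⟨x.cost + 20 + K,
    fun D h N c σ₀ W hD hm hN hxo hxc hc₁ hc₂ hW hopt => ?_⟩
  have hpos : 0 < D.m := by rw [hm]; positivity
  have h0 : 0 < N := by omega
  have hm2 : 2 * D.m = 2 ^ (h + 1) := by rw [hm]; ring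
  refine (Runs.seq (c := x.cost + 2) (c' := (h + 1) * (4 + K) + 4)
    ((Runs.of_wp ?_).mono (by simp only [Program.maxCost, WExpr.cost]; omega)
      (Q := fun σ => σ = σ₀.setWord 8 0 c) ?_)).mono ?_ (fun _ h => h)
  · simp only [Program.wp, WExpr.Ok, WExpr.eval, hxc]
    exact ⟨by omega, by omega, hxo, trivial⟩
  · rintro σ rfl
    have hE : ∀ τ x κ v, entry (State.setWord τ 8 0 x) κ v = entry τ κ v := by
      intro τ x κ v
      simp [entry, show ∀ x, ¬ 100 + x = 8 by omega, show ∀ x, ¬ 101 + x = 8 by omega,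
        show ∀ x, ¬ 102 + x = 8 by omega, show ∀ x, ¬ 103 + x = 8 by omega]
    -- After `k` rounds, only the ancestors of `c` of height at least `k` are still to be computed.
    refine (Runs.loop (b := .wordLt (.const 0) (.var 8)) (fun k τ => τ.word 8 0 = c / 2 ^ k ∧
      SameVars σ₀ τ ∧ ∀ v, 1 ≤ v → v < 2 * D.m → (∀ e, k ≤ e → v ≠ c / 2 ^ e) →
        NodeOpt (D.weightAt σ₀) h τ v)
      (h + 1) ?_ ?_ ?_).mono le_rfl ?_
    · rintro k τ hk ⟨h₁, h₂, h₃⟩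
      have hck : 1 ≤ c / 2 ^ k := by
        rw [Nat.one_le_div_iff (by positivity)]
        exact (Nat.pow_le_pow_right (by norm_num) (by omega)).trans (hm ▸ hc₁)
      have hck' : c / 2 ^ k ≤ c := Nat.div_le_self _ _
      have hanc : ∀ e, k ≤ e → c / 2 ^ e ≤ c / 2 ^ k := fun e he =>
        Nat.div_le_div_left (Nat.pow_le_pow_right (by norm_num) he) (by positivity)
      simp only [Test.Ok, Test.Holds, WExpr.Ok, WExpr.eval, h₁]
      refine ⟨by omega, by omega, ?_⟩
      refine hK _ _ _ (Program.wp_seq.2 (computeNode_wp (v := c / 2 ^ k) (h₂.holds hD) hm hN h₁ hck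
        (by omega) ?_ ?_))
      · intro hlt
        rw [h₂.weightAt]
        exact ⟨h₃ _ (by omega) (by omega) fun e he => by have := hanc e he; omega,
          h₃ _ (by omega) (by omega) fun e he => by have := hanc e he; omega⟩
      · rw [h₂.weightAt]
        intro υ g₁ g₂ g₃ g₄
        have hυ : υ.word 8 0 = c / 2 ^ k := by rw [g₂, h₁]
        simp only [Program.wp, WExpr.Ok, WExpr.eval, hυ]
        refine ⟨h0, h0, ⟨⟨h0, h0⟩, by omega, by omega⟩, ?_, ?_, fun v hv₁ hv₂ hv => ?_⟩
        · simp [pow_succ, Nat.div_div_eq_div_mul]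
        · exact (h₂.trans g₁).trans (SameVars.setNode _ _)
        · refine NodeOpt.of_entry_eq (σ := υ) ?_ fun κ => hE _ _ κ v
          by_cases hvk : v = c / 2 ^ k
          · rw [hvk]; exact g₄
          · refine (h₃ v hv₁ hv₂ fun e he => ?_).of_entry_eq fun κ => g₃ κ v hvk
            rcases he.eq_or_lt with rfl | he
            · exact hvk
            · exact hv e he
    · rintro τ ⟨h₁, -, -⟩
      have : c / 2 ^ (h + 1) = 0 := Nat.div_eq_of_lt (by omega)
      simp only [Test.Ok, Test.Holds, WExpr.Ok, WExpr.eval, h₁, this]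
      omega
    · refine ⟨by simp, SameVars.setNode _ _, fun v h₁ h₂ hv => ?_⟩
      refine NodeOpt.of_entry_eq (σ := σ₀) ?_ fun κ => hE _ _ κ v
      intro e he₁ he₂ κ hκ
      have hle := add_one_mul_two_pow_le h₁ he₂
      rw [add_mul, one_mul] at hle
      refine (hopt v h₁ h₂ e he₁ he₂ κ hκ).congr fun c' hc₁' hc₂' => ?_
      refine hW c' (by omega) (by omega) ?_
      rintro rfl
      refine hv e (Nat.zero_le _) (Nat.div_eq_of_lt_le hc₁' ?_).symm
      rwa [Nat.succ_mul]
    · rintro τ ⟨-, h₂, h₃⟩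
      refine ⟨h₂, fun v hv₁ hv₂ => h₃ v hv₁ hv₂ fun e he hve => ?_⟩
      have : c / 2 ^ e = 0 := Nat.div_eq_of_lt
        (lt_of_lt_of_le (by omega) (Nat.pow_le_pow_right (n := 2) (by norm_num) he))
      omega
  · have e₂ : (x.cost + 20 + K) * (h + 1)
        = (x.cost + 16) * h + (x.cost + 16) + (h + 1) * (4 + K) := by ring
    omega

end TwoBoxes

/-! ### The search -/

namespace TwoBoxes

open RealRAM

/-- The states in which both intervals are unrestricted. -/
def rootKey : Key := ⟨0, 2, 0, 2⟩

/-- The best value found so far. -/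
def best (σ : State) : ℝ := σ.real 3 8

/-- `V` is an upper bound for the weights of pairs of boxes whose ordinates range over the ranks in
`[i, j)` and in `[k, l)`. -/
def Data.Bound (D : Data) (V : ℝ) (i j k l : ℕ) : Prop :=
  ∀ a₁ a₂ b₁ b₂, D.m ≤ a₁ → a₁ ≤ a₂ → a₂ ≤ 2 * D.m → D.m ≤ b₁ → b₁ ≤ b₂ → b₂ ≤ 2 * D.m →
    total (D.weight i j k l) D.m (2 * D.m) a₁ a₂ b₁ b₂ ≤ V

theorem Data.Bound.mono {D : Data} {V V' : ℝ} {i j k l : ℕ} (h : D.Bound V i j k l) (hV : V ≤ V') :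
    D.Bound V' i j k l := fun a₁ a₂ b₁ b₂ h₁ h₂ h₃ h₄ h₅ h₆ =>
  (h a₁ a₂ b₁ b₂ h₁ h₂ h₃ h₄ h₅ h₆).trans hV

/-- The best value is the value of the solution kept in the word variables `20`, …, `27`. -/
def Data.Attained (D : Data) (σ : State) : Prop :=
  σ.word 20 0 ≤ σ.word 21 0 ∧ σ.word 21 0 ≤ D.n ∧ σ.word 22 0 ≤ σ.word 23 0 ∧
  σ.word 23 0 ≤ D.n ∧ σ.word 24 0 ≤ σ.word 25 0 ∧ σ.word 25 0 ≤ 2 * D.m ∧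
  σ.word 26 0 ≤ σ.word 27 0 ∧ σ.word 27 0 ≤ 2 * D.m ∧
  best σ = total (D.weight (σ.word 20 0) (σ.word 21 0) (σ.word 22 0) (σ.word 23 0)) D.m (2 * D.m)
    (σ.word 24 0) (σ.word 25 0) (σ.word 26 0) (σ.word 27 0)

theorem Data.Attained.congr {D : Data} {σ τ : State} (h : D.Attained σ)
    (hw : ∀ a, 20 ≤ a → a < 28 → τ.word a 0 = σ.word a 0) (hr : best τ = best σ) :
    D.Attained τ := by
  simpa only [Data.Attained, hr, hw 20 (by omega) (by omega), hw 21 (by omega) (by omega),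
    hw 22 (by omega) (by omega), hw 23 (by omega) (by omega), hw 24 (by omega) (by omega),
    hw 25 (by omega) (by omega), hw 26 (by omega) (by omega),
    hw 27 (by omega) (by omega)] using h

/-- Passing from `σ` to `τ`, the search has not lost anything and has kept the variables with
numbers below `b`. -/
structure Data.Progress (D : Data) (b : ℕ) (σ τ : State) : Prop where
  holds : D.Holds τ
  attained : D.Attained τ
  le : best σ ≤ best τ
  word : ∀ a < b, τ.word a 0 = σ.word a 0

theorem Data.Progress.trans {D : Data} {b b' : ℕ} {σ τ υ : State} (h : D.Progress b σ τ)
    (h' : D.Progress b' τ υ) (hb : b ≤ b') : D.Progress b σ υ where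
  holds := h'.holds
  attained := h'.attained
  le := h.le.trans h'.le
  word a ha := (h'.word a (by omega)).trans (h.word a ha)

theorem Data.Progress.setVar {D : Data} {b v : ℕ} {σ τ : State} (h : D.Progress b σ τ)
    (h₁ : 4 ≤ v) (h₂ : v < 20) (h₃ : b ≤ v) (x : ℕ) : D.Progress b σ (τ.setWord v 0 x) where
  holds :=
    { n := by rw [State.word_setWord_of_ne _ _ _ (by omega), h.holds.n]
      m := by rw [State.word_setWord_of_ne _ _ _ (by omega), h.holds.m]
      yr := by rw [State.word_setWord_of_ne _ _ _ (by omega), h.holds.yr]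
      xr := by rw [State.word_setWord_of_ne _ _ _ (by omega), h.holds.xr]
      X := h.holds.X
      Y := h.holds.Y
      w := h.holds.w }
  attained := h.attained.congr
    (fun a h₁ h₂ => by rw [State.word_setWord_of_ne _ _ _ (by omega)]) rfl
  le := h.le
  word a ha := by rw [State.word_setWord_of_ne _ _ _ (by omega), h.word a ha]

theorem SameVars.progress {D : Data} {σ τ : State} (h : SameVars σ τ) (hD : D.Holds σ)
    (hA : D.Attained σ) : D.Progress 8 σ τ where
  holds := h.holds hD
  attained := hA.congr (fun a _ _ => by rw [h.1 a (by omega) (by omega)])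
    (by rw [best, best, h.2 3 (by omega) (by omega)])
  le := by rw [best, best, h.2 3 (by omega) (by omega)]
  word a ha := by rw [h.1 a (by omega) (by omega)]

/-- If the root of the tree is better than the best solution so far, then replace the latter. -/
def recordBest : Program :=
  .branch (.realLt (.cell 3 (.const 8)) (.cell (100 + rootKey.code) (.const 1)))
    (.seq (.assign 20 (.var 4)) (.seq (.assign 21 (.var 5)) (.seq (.assign 22 (.var 6))
    (.seq (.assign 23 (.var 7))
    (.seq (.assign 24 (.cell (100 + 4 * rootKey.code) (.const 1)))
    (.seq (.assign 25 (.cell (101 + 4 * rootKey.code) (.const 1)))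
    (.seq (.assign 26 (.cell (102 + 4 * rootKey.code) (.const 1)))
    (.seq (.assign 27 (.cell (103 + 4 * rootKey.code) (.const 1)))
    (.setReal 3 (.const 8) (.cell (100 + rootKey.code) (.const 1)))))))))))
    .nop

theorem recordBest_wp {D : Data} {h N : ℕ} {σ : State} {Q : State → Prop} (hN : 8 < N)
    (hm : D.m = 2 ^ h) (hD : D.Holds σ) (hA : D.Attained σ)
    (hT : NodeOpt (D.weightAt σ) h σ 1)
    (hi : σ.word 4 0 ≤ σ.word 5 0) (hj : σ.word 5 0 ≤ D.n) (hk : σ.word 6 0 ≤ σ.word 7 0)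
    (hl : σ.word 7 0 ≤ D.n)
    (hQ : ∀ τ, D.Progress 8 σ τ → (∀ κ v, entry τ κ v = entry σ κ v) →
      D.Bound (best τ) (σ.word 4 0) (σ.word 5 0) (σ.word 6 0) (σ.word 7 0) → Q τ) :
    recordBest.wp N Q σ := by
  have hroot := hT h (by simp) (by rw [one_mul, pow_succ]; have : 0 < 2 ^ h := by positivity
                                   omega) rootKey ⟨by decide, by decide, by decide, by decide⟩
  rw [one_mul, ← hm, ← two_mul] at hroot
  obtain ⟨hA₁, hB₁, hval, hmax⟩ := hroot
  have hbound : D.Bound (entry σ rootKey 1).val (σ.word 4 0) (σ.word 5 0) (σ.word 6 0)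
      (σ.word 7 0) := by
    intro a₁ a₂ b₁ b₂ h₁ h₂ h₃ h₄ h₅ h₆
    refine hmax a₁ a₂ b₁ b₂ ?_ ?_ <;> simp only [Segment, rootKey] <;> omega
  have h0 : 0 < N := by omega
  have h1 : 1 < N := by omega
  simp only [Segment, rootKey, entry] at hA₁ hB₁
  simp only [recordBest, Program.wp, Test.Ok, Test.Holds, WExpr.Ok, WExpr.eval, RExpr.Ok,
    RExpr.eval, h0, h1, hN, and_self, true_and]
  refine ⟨fun hlt => ?_, fun hge => ?_⟩
  · refine hQ _ ?_ ?_ ?_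
    · refine ⟨⟨?_, ?_, ?_, ?_, ?_, ?_, ?_⟩, ?_, ?_, ?_⟩
      · simp [hD.n]
      · simp [hD.m]
      · funext i; simp [hD.yr]
      · funext i; simp [hD.xr]
      · funext i; simp [hD.X]
      · funext i; simp [hD.Y]
      · funext i; simp [hD.w]
      · simp only [Data.Attained, best]
        simp [rootKey, Key.code] at hA₁ hB₁ ⊢
        refine ⟨hi, hj, hk, hl, by omega, by omega, by omega, by omega, ?_⟩
        simpa [entry, rootKey, Key.code, Data.weightAt] using hval
      · simpa [best] using hlt.le
      · intro a ha
        simp [show a ≠ 20 by omega, show a ≠ 21 by omega, show a ≠ 22 by omega,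
          show a ≠ 23 by omega, show a ≠ 24 by omega, show a ≠ 25 by omega, show a ≠ 26 by omega,
          show a ≠ 27 by omega]
    · intro κ v
      have e : ∀ x y, y < 100 → ¬ 100 + x = y := by omega
      have e₁ : ∀ x y, y < 100 → ¬ 101 + x = y := by omega
      have e₂ : ∀ x y, y < 100 → ¬ 102 + x = y := by omega
      have e₃ : ∀ x y, y < 100 → ¬ 103 + x = y := by omega
      simp [entry, e, e₁, e₂, e₃]
    · simpa [best, entry] using hbound
  · refine hQ σ ⟨hD, hA, le_rfl, fun _ _ => rfl⟩ (fun _ _ => rfl) (hbound.mono ?_)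
    exact not_lt.1 hge

-- Unification must not unfold the program text.
attribute [irreducible] recordBest

/-- The loop bound `n + 1`. -/
def boundExpr : WExpr := .add (.var 0) (.const 1)

/-- `for v := e to n do P`. -/
def sweep (v : ℕ) (e : WExpr) (P : Program) : Program :=
  .seq (.assign v e) (.forUp v boundExpr P)

theorem boundExpr_spec {D : Data} {N : ℕ} {σ : State} (hD : D.Holds σ) (hN : D.n + 1 < N) :
    boundExpr.Ok N σ ∧ boundExpr.eval σ = D.n + 1 := by
  have := hD.n
  simp only [boundExpr, WExpr.Ok, WExpr.eval, this, and_true]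
  omega

theorem sweep_runs {v : ℕ} {e : WExpr} {P : Program} {K M N a : ℕ} {D : Data} {σ₀ : State}
    (hM : 1 ≤ M) (hv₁ : 4 ≤ v) (hv₂ : v < 20) (hN : D.n + 2 < N) (heo : e.Ok N σ₀)
    (hea : e.eval σ₀ = a) (ha : a ≤ D.n) (G : ℕ → ℝ → Prop)
    (hG : ∀ x V V', V ≤ V' → G x V → G x V')
    (hbody : ∀ σ x, a ≤ x → x ≤ D.n → D.Progress v σ₀ σ → σ.word v 0 = x →
      Runs N P σ (K * M) fun τ => D.Progress (v + 1) σ τ ∧ G x (best τ))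
    (hD : D.Holds σ₀) (hA : D.Attained σ₀) :
    Runs N (sweep v e P) σ₀ ((K + e.cost + 30) * ((D.n + 1) * M)) fun τ =>
      D.Progress v σ₀ τ ∧ ∀ x, a ≤ x → x ≤ D.n → G x (best τ) := by
  have h0 : 0 < N := by omega
  have hP₀ : D.Progress v σ₀ σ₀ := ⟨hD, hA, le_rfl, fun _ _ => rfl⟩
  refine (Runs.seq (c := e.cost + 2) (c' := (K + 2 * boundExpr.cost + 12) * ((D.n + 1) * M))
    ((Runs.of_wp ?_).mono (by simp only [Program.maxCost, WExpr.cost]; omega)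
      (Q := fun σ => σ = σ₀.setWord v 0 a) ?_)).mono ?_ (fun _ h => h)
  · simp only [Program.wp, WExpr.Ok, WExpr.eval, hea]
    exact ⟨h0, h0, heo, trivial⟩
  · rintro σ rfl
    refine (Runs.forUp (r := D.n + 1) (a := a) (b := D.n + 1) (fun k τ => D.Progress v σ₀ τ ∧
      ∀ x, a ≤ x → x < k → G x (best τ)) (by omega) (by omega) hM (by omega) (by omega)
      (fun k τ h => boundExpr_spec h.1.holds (by omega)) ?_ (by simp) ?_).mono le_rfl ?_
    · rintro k τ h₁ h₂ h₃ ⟨h₄, h₅⟩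
      refine (hbody τ k h₁ (by omega) h₄ h₃).mono le_rfl ?_
      rintro υ ⟨g₁, g₂⟩
      refine ⟨(g₁.word v (by omega)).trans h₃, (h₄.trans g₁ (by omega)).setVar hv₁ hv₂ le_rfl _,
        fun x hx hxk => ?_⟩
      rcases (Nat.lt_succ_iff.1 hxk).eq_or_lt with rfl | hlt
      · exact g₂
      · exact hG x _ _ g₁.le (h₅ x hx hlt)
    · exact ⟨hP₀.setVar hv₁ hv₂ le_rfl _, fun x _ _ => by omega⟩
    · rintro τ ⟨-, h₁, h₂⟩
      exact ⟨h₁, fun x hx hx' => h₂ x hx (by omega)⟩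
  · have h₁ : 1 ≤ (D.n + 1) * M := Nat.mul_pos (by omega) hM
    simp only [boundExpr, WExpr.cost]
    nlinarith

/-- The node of the leaf for the ordinate of rank `l - 1`. For `l = 0` the subtraction is truncated;
the leaf obtained is then recomputed without need, which does no harm. -/
def leafExpr : WExpr := .add (.var 1) (.cell 3 (.sub (.var 7) (.const 1)))

/-- For given `i`, `j`, `k`, try all values of `l`, starting with `l = k`, where `B` is without
points. -/
def searchL : Program :=
  .seq (.assign 7 (.var 6)) (.seq buildTree
    (.forUp 7 boundExpr (.seq (updateTree leafExpr) recordBest)))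

/-- The data are consistent: `xr` and `yr` connect the two ranks of each point, and the tree has
`O(n)` leaves. -/
structure Data.Good (D : Data) (h : ℕ) : Prop where
  m_eq : D.m = 2 ^ h
  m_le : D.m ≤ 2 * (D.n + 1)
  xr_lt : ∀ r, D.xr r < D.m
  xr_yr : ∀ c, D.w c ≠ 0 → D.xr (D.yr c) = c

theorem Data.Good.weight_succ {D : Data} {h : ℕ} (hG : D.Good h) (i j k l : ℕ) {c : ℕ}
    (hc : D.m ≤ c) (hne : c ≠ D.m + D.xr l) :
    D.weight i j k l c = D.weight i j k (l + 1) c := by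
  funext α β
  by_cases hw : D.w (c - D.m) = 0
  · simp [Data.weight, hw]
  · have hy : D.yr (c - D.m) ≠ l := by
      rintro rfl
      rw [hG.xr_yr _ hw] at hne
      omega
    have : (k ≤ D.yr (c - D.m) ∧ D.yr (c - D.m) < l) ↔
        (k ≤ D.yr (c - D.m) ∧ D.yr (c - D.m) < l + 1) := by omega
    simp only [Data.weight, this]

theorem searchL_runs : ∃ K, ∀ (D : Data) (h N : ℕ) (σ : State), D.Good h → D.n + 2 < N →
    2 * D.m + 8 < N → D.Holds σ → D.Attained σ → σ.word 4 0 ≤ σ.word 5 0 → σ.word 5 0 ≤ D.n →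
    σ.word 6 0 ≤ D.n → Runs N searchL σ (K * ((D.n + 1) * (h + 1))) fun τ => D.Progress 7 σ τ ∧
      ∀ l, σ.word 6 0 ≤ l → l ≤ D.n →
        D.Bound (best τ) (σ.word 4 0) (σ.word 5 0) (σ.word 6 0) l := by
  obtain ⟨K₁, hK₁⟩ := buildTree_runs
  obtain ⟨K₂, hK₂⟩ := updateTree_runs leafExpr
  obtain ⟨K₃, hK₃⟩ := Runs.exists_cost recordBest
  refine ⟨4 + (2 * K₁ + (K₂ + K₃ + 2 * boundExpr.cost + 12)),
    fun D h N σ₀ hG hN hN' hD hA hi hj hk => ?_⟩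
  obtain ⟨i, hi'⟩ : ∃ i, i = σ₀.word 4 0 := ⟨_, rfl⟩
  obtain ⟨j, hj'⟩ : ∃ j, j = σ₀.word 5 0 := ⟨_, rfl⟩
  obtain ⟨k, hk'⟩ : ∃ k, k = σ₀.word 6 0 := ⟨_, rfl⟩
  rw [← hi', ← hj'] at hi
  rw [← hj'] at hj
  rw [← hk'] at hk
  rw [← hi', ← hj', ← hk']
  have h0 : 0 < N := by omega
  have hm0 : 0 < D.m := by rw [hG.m_eq]; positivity
  have hP₀ : D.Progress 7 σ₀ σ₀ := ⟨hD, hA, le_rfl, fun _ _ => rfl⟩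
  refine (Runs.seq (c := 4) (c' := 2 * K₁ * (D.n + 1) +
      (K₂ + K₃ + 2 * boundExpr.cost + 12) * ((D.n + 1) * (h + 1)))
    ((Runs.of_wp ?_).mono (by simp [Program.maxCost, WExpr.cost])
      (Q := fun σ => σ = σ₀.setWord 7 0 k) ?_)).mono ?_ (fun _ h => h)
  · simp only [Program.wp, WExpr.Ok, WExpr.eval, ← hk']
    exact ⟨h0, h0, ⟨h0, h0⟩, trivial⟩
  · rintro σ rfl
    have hP₁ := hP₀.setVar (v := 7) (by omega) (by omega) le_rfl k
    have hw : ∀ τ, D.Progress 7 σ₀ τ → τ.word 4 0 = i ∧ τ.word 5 0 = j ∧ τ.word 6 0 = k :=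
      fun τ h => ⟨by rw [h.word 4 (by omega), hi'], by rw [h.word 5 (by omega), hj'],
        by rw [h.word 6 (by omega), hk']⟩
    refine Runs.seq ((hK₁ D h N _ hP₁.holds hG.m_eq (by omega)).mono ?_ ?_)
    · have := Nat.mul_le_mul_left K₁ hG.m_le
      linarith
    rintro τ ⟨hS, hT⟩
    have hP₂ := hP₁.trans (hS.progress hP₁.holds hP₁.attained) (by omega)
    have hτ7 : τ.word 7 0 = k := by rw [hS.1 7 (by omega) (by omega)]; simp
    have hW : D.weightAt (σ₀.setWord 7 0 k) = D.weight i j k k := by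
      simp [Data.weightAt, hi', hj', hk']
    rw [hW] at hT
    -- Before the round for `l`, the tree is up to date except for the leaf of rank `l - 1`.
    refine (Runs.forUp (K := K₂ + K₃) (M := h + 1) (r := D.n + 1) (b := D.n + 1)
      (fun l υ => D.Progress 7 σ₀ υ ∧ (∃ l', (∀ c, D.m ≤ c → c < 2 * D.m →
          c ≠ D.m + D.xr (l - 1) → D.weight i j k l' c = D.weight i j k l c) ∧
          ∀ v, 1 ≤ v → v < 2 * D.m → NodeOpt (D.weight i j k l') h υ v) ∧
        ∀ l', k ≤ l' → l' < l → D.Bound (best υ) i j k l')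
      (by omega) (by omega) (by omega) (by omega) (by omega)
      (fun k τ h => boundExpr_spec h.1.holds (by omega)) ?_ hτ7 ?_).mono le_rfl ?_
    · rintro l υ hkl hln hl ⟨hP, ⟨l', hl'₁, hl'₂⟩, hB⟩
      obtain ⟨w4, w5, w6⟩ := hw υ hP
      have hWυ : D.weightAt υ = D.weight i j k l := by simp only [Data.weightAt, w4, w5, w6, hl]
      have hυ1 : υ.word 1 0 = D.m := hP.holds.m
      have hυ3 : υ.word 3 (l - 1) = D.xr (l - 1) := by rw [hP.holds.xr]
      have hxr := hG.xr_lt (l - 1)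
      refine Runs.mono (c := K₂ * (h + 1) + K₃) (Runs.seq ((hK₂ D h N (D.m + D.xr (l - 1)) υ
        (D.weight i j k l') hP.holds hG.m_eq (by omega) ?_ ?_ (by omega) (by omega) ?_ hl'₂).mono
        le_rfl ?_)) (by nlinarith) (fun _ h => h)
      · simp only [leafExpr, WExpr.Ok, WExpr.eval, hl, hυ1, hυ3]
        omega
      · simp only [leafExpr, WExpr.eval, hl, hυ1, hυ3]
      · rwa [hWυ]
      rintro ρ ⟨hS', hT'⟩
      have hPρ := hS'.progress hP.holds hP.attained
      have hPρ' := hP.trans hPρ (by omega)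
      obtain ⟨r4, r5, r6⟩ := hw ρ hPρ'
      have r7 : ρ.word 7 0 = l := (hPρ.word 7 (by omega)).trans hl
      have hWρ : D.weightAt ρ = D.weight i j k l := by simp only [Data.weightAt, r4, r5, r6, r7]
      rw [hWυ] at hT'
      refine hK₃ _ _ _ (recordBest_wp (by omega) hG.m_eq hPρ.holds hPρ.attained ?_ (by omega)
        (by omega) (by omega) (by omega) fun ω g₁ g₂ g₃ => ?_)
      · rw [hWρ]
        exact hT' 1 le_rfl (by omega)
      rw [r4, r5, r6, r7] at g₃
      have hPω := hPρ'.trans g₁ (by omega)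
      refine ⟨(g₁.word 7 (by omega)).trans r7, hPω.setVar (by omega) (by omega) le_rfl _,
        ⟨l, ?_, ?_⟩, ?_⟩
      · intro c hc _ hne
        exact hG.weight_succ i j k l hc hne
      · intro v hv₁ hv₂
        refine (hT' v hv₁ hv₂).of_entry_eq fun κ => ?_
        rw [← g₂]
        simp [entry, show ∀ x, ¬ 100 + x = 7 by omega, show ∀ x, ¬ 101 + x = 7 by omega,
          show ∀ x, ¬ 102 + x = 7 by omega, show ∀ x, ¬ 103 + x = 7 by omega]
      · intro l'' h₁ h₂
        rcases (Nat.lt_succ_iff.1 h₂).eq_or_lt with rfl | hlt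
        · exact g₃
        · exact (hB l'' h₁ hlt).mono (hPρ.le.trans g₁.le)
    · exact ⟨hP₂, ⟨k, fun _ _ _ _ => rfl, hT⟩, fun l' _ _ => by omega⟩
    · rintro υ ⟨-, h₁, -, h₂⟩
      exact ⟨h₁, fun l h₃ h₄ => h₂ l h₃ (by omega)⟩
  · have e₁ : 1 ≤ (D.n + 1) * (h + 1) := Nat.mul_pos (by omega) (by omega)
    have e₂ : 2 * K₁ * (D.n + 1) ≤ 2 * K₁ * ((D.n + 1) * (h + 1)) :=
      Nat.mul_le_mul_left _ (Nat.le_mul_of_pos_right _ (by omega))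
    nlinarith

/-- Try all values of `i ≤ j` and `k ≤ l`. -/
def search : Program :=
  sweep 4 (.const 0) (sweep 5 (.var 4) (sweep 6 (.const 0) searchL))

theorem search_runs : ∃ K, ∀ (D : Data) (h N : ℕ) (σ : State), D.Good h → D.n + 2 < N →
    2 * D.m + 8 < N → D.Holds σ → D.Attained σ →
    Runs N search σ (K * ((D.n + 1) ^ 4 * (h + 1))) fun τ => D.Holds τ ∧ D.Attained τ ∧
      ∀ i j k l, i ≤ j → j ≤ D.n → k ≤ l → l ≤ D.n → D.Bound (best τ) i j k l := by
  obtain ⟨K, hK⟩ := searchL_runs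
  refine ⟨K + 100, fun D h N σ₀ hG hN hN' hD hA => ?_⟩
  have h0 : 0 < N := by omega
  have hM₁ : 1 ≤ (D.n + 1) * (h + 1) := Nat.mul_pos (by omega) (by omega)
  have hM₂ : 1 ≤ (D.n + 1) * ((D.n + 1) * (h + 1)) := Nat.mul_pos (by omega) hM₁
  have hM₃ : 1 ≤ (D.n + 1) * ((D.n + 1) * ((D.n + 1) * (h + 1))) := Nat.mul_pos (by omega) hM₂
  refine (sweep_runs (e := .const 0) (σ₀ := σ₀) (K := K + (WExpr.const 0).cost + 30 + (WExpr.var 4).cost + 30) (a := 0) hM₃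
    (by omega) (by omega) hN h0 rfl (by omega)
    (fun i V => ∀ j k l, i ≤ j → j ≤ D.n → k ≤ l → l ≤ D.n → D.Bound V i j k l)
    (fun i V V' hV h j k l h₁ h₂ h₃ h₄ => (h j k l h₁ h₂ h₃ h₄).mono hV) ?_ hD hA).mono ?_ ?_
  · intro σ i _ hin hP hi
    refine (sweep_runs (e := .var 4) (σ₀ := σ) (K := K + (WExpr.const 0).cost + 30) (a := i) hM₂
      (by omega) (by omega) hN ⟨h0, h0⟩ hi hin
      (fun j V => ∀ k l, k ≤ l → l ≤ D.n → D.Bound V i j k l)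
      (fun j V V' hV h k l h₁ h₂ => (h k l h₁ h₂).mono hV) ?_ hP.holds hP.attained).mono le_rfl ?_
    · intro σ' j hij hjn hP' hj
      have hi' : σ'.word 4 0 = i := (hP'.word 4 (by omega)).trans hi
      refine (sweep_runs (e := .const 0) (σ₀ := σ') (K := K) (a := 0) hM₁
        (by omega) (by omega) hN h0 rfl (by omega)
        (fun k V => ∀ l, k ≤ l → l ≤ D.n → D.Bound V i j k l)
        (fun k V V' hV h l h₁ h₂ => (h l h₁ h₂).mono hV) ?_ hP'.holds hP'.attained).mono le_rfl ?_
      · intro υ k _ hkn hP'' hk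
        have hi'' : υ.word 4 0 = i := (hP''.word 4 (by omega)).trans hi'
        have hj'' : υ.word 5 0 = j := (hP''.word 5 (by omega)).trans hj
        have := hK D h N υ hG hN hN' hP''.holds hP''.attained (by omega) (by omega) (by omega)
        rwa [hi'', hj'', hk] at this
      · rintro τ ⟨h₁, h₂⟩
        exact ⟨h₁, fun k l hkl hl => h₂ k (Nat.zero_le _) (hkl.trans hl) l hkl hl⟩
    · rintro τ ⟨h₁, h₂⟩
      exact ⟨h₁, fun j k l hij hj hkl hl => h₂ j hij hj k l hkl hl⟩
  · simp only [WExpr.cost]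
    have e : (D.n + 1) * ((D.n + 1) * ((D.n + 1) * ((D.n + 1) * (h + 1))))
      = (D.n + 1) ^ 4 * (h + 1) := by ring
    rw [e]
    exact Nat.mul_le_mul_right _ (by omega)
  · rintro τ ⟨h₁, h₂⟩
    exact ⟨h₁.holds, h₁.attained, fun i j k l hij hj hkl hl =>
      h₂ i (Nat.zero_le _) (hij.trans hj) j k l hij hj hkl hl⟩

end TwoBoxes

/-! ### Sorting by rank -/

namespace TwoBoxes

open RealRAM

/-- The number of the first `k` values of `f` that are smaller than `a`. -/
noncomputable def countBelow (f : ℕ → ℝ) (k : ℕ) (a : ℝ) : ℕ := by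
  classical exact ((Finset.range k).filter fun p => f p < a).card

theorem countBelow_zero (f : ℕ → ℝ) (a : ℝ) : countBelow f 0 a = 0 := by simp [countBelow]

theorem countBelow_succ (f : ℕ → ℝ) (k : ℕ) (a : ℝ) :
    countBelow f (k + 1) a = countBelow f k a + (open Classical in if f k < a then 1 else 0) := by
  classical
  simp only [countBelow, Finset.range_add_one, Finset.filter_insert]
  split_ifs
  · rw [Finset.card_insert_of_notMem (by simp)]
  · rfl

theorem countBelow_le (f : ℕ → ℝ) (k : ℕ) (a : ℝ) : countBelow f k a ≤ k := by
  classical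
  exact (Finset.card_filter_le _ _).trans (Finset.card_range k).le

/-- The number of values among `f 0`, …, `f (n - 1)` that are smaller than `f q`. -/
noncomputable def rank (f : ℕ → ℝ) (n q : ℕ) : ℕ := countBelow f n (f q)

theorem rank_lt {f : ℕ → ℝ} {n q : ℕ} (hq : q < n) : rank f n q < n := by
  classical
  have : ((Finset.range n).filter fun p => f p < f q) ⊂ Finset.range n := by
    refine Finset.filter_ssubset.2 ⟨q, Finset.mem_range.2 hq, lt_irrefl _⟩
  simpa [rank, countBelow] using Finset.card_lt_card this

theorem countBelow_mono (f : ℕ → ℝ) (n : ℕ) {a b : ℝ} (h : a ≤ b) :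
    countBelow f n a ≤ countBelow f n b := by
  classical
  exact Finset.card_le_card (Finset.monotone_filter_right _ fun p _ hp => lt_of_lt_of_le hp h)

theorem rank_lt_countBelow {f : ℕ → ℝ} {n q : ℕ} (hq : q < n) {a : ℝ} (h : f q < a) :
    rank f n q < countBelow f n a := by
  classical
  unfold rank countBelow
  refine Finset.card_lt_card ((Finset.ssubset_iff_of_subset fun p hp => ?_).2
    ⟨q, by simp [hq, h], by simp⟩)
  rw [Finset.mem_filter] at hp ⊢
  exact ⟨hp.1, hp.2.trans h⟩

theorem rank_lt_rank_iff {f : ℕ → ℝ} {n p q : ℕ} (hp : p < n) :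
    rank f n p < rank f n q ↔ f p < f q := by
  refine ⟨fun h => ?_, rank_lt_countBelow hp⟩
  by_contra hle
  exact absurd (countBelow_mono f n (not_lt.1 hle)) (not_le.2 h)

theorem rank_injOn {f : ℕ → ℝ} {n : ℕ} (hf : Set.InjOn f (Set.Iio n)) :
    Set.InjOn (rank f n) (Set.Iio n) := by
  intro p hp q hq h
  refine hf hp hq (le_antisymm ?_ ?_)
  · exact not_lt.1 fun hlt => (h ▸ (rank_lt_rank_iff hq).2 hlt).false
  · exact not_lt.1 fun hlt => (h ▸ (rank_lt_rank_iff hp).2 hlt).false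

theorem image_rank {f : ℕ → ℝ} {n : ℕ} (hf : Set.InjOn f (Set.Iio n)) :
    (Finset.range n).image (rank f n) = Finset.range n := by
  refine Finset.eq_of_subset_of_card_le ?_ ?_
  · intro r hr
    obtain ⟨q, hq, rfl⟩ := Finset.mem_image.1 hr
    exact Finset.mem_range.2 (rank_lt (Finset.mem_range.1 hq))
  · rw [Finset.card_image_of_injOn]
    intro p hp q hq h
    exact rank_injOn hf (by simpa using hp) (by simpa using hq) h

theorem exists_rank_eq {f : ℕ → ℝ} {n r : ℕ} (hf : Set.InjOn f (Set.Iio n)) (hr : r < n) :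
    ∃ q < n, rank f n q = r := by
  have := Finset.mem_range.2 hr
  rw [← image_rank hf] at this
  obtain ⟨q, hq, h⟩ := Finset.mem_image.1 this
  exact ⟨q, Finset.mem_range.1 hq, h⟩

/-- Let `m` be the least power of two that is at least `n`. -/
def computeSize : Program :=
  .seq (.assign 1 (.const 1))
    (.loop (.wordLt (.var 1) (.var 0)) (.assign 1 (.add (.var 1) (.var 1))))

theorem two_pow_clog_le (n : ℕ) : 2 ^ Nat.clog 2 n ≤ 2 * (n + 1) := by
  rcases Nat.lt_or_ge 1 n with hn | hn
  · have h₁ := Nat.pow_pred_clog_lt_self (b := 2) (by norm_num) hn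
    have h₂ : 0 < Nat.clog 2 n := Nat.clog_pos (by norm_num) hn
    obtain ⟨k, hk⟩ := Nat.exists_eq_succ_of_ne_zero h₂.ne'
    rw [hk] at h₁ ⊢
    simp only [Nat.pred_succ, Nat.succ_eq_add_one] at h₁ ⊢
    rw [pow_succ]
    omega
  · rw [Nat.clog_of_right_le_one hn]
    omega

theorem computeSize_runs {N n : ℕ} {σ : State} (hn : σ.word 0 0 = n) (hN : 4 * n + 4 < N) :
    Runs N computeSize σ (20 * (Nat.clog 2 n + 1)) fun τ => τ.word 1 0 = 2 ^ Nat.clog 2 n ∧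
      (∀ a, a ≠ 1 → τ.word a = σ.word a) ∧ τ.real = σ.real := by
  have h0 : 0 < N := by omega
  refine (Runs.seq (c := 3) (c' := Nat.clog 2 n * (5 + 7) + 5)
    ((Runs.of_wp ?_).mono (by simp [Program.maxCost, WExpr.cost])
      (Q := fun τ => τ = σ.setWord 1 0 1) ?_)).mono (by omega) (fun _ h => h)
  · simp only [Program.wp, WExpr.Ok, WExpr.eval]
    exact ⟨h0, h0, by omega, trivial⟩
  · rintro τ rfl
    refine (Runs.loop (b := .wordLt (.var 1) (.var 0)) (c := 7) (fun k τ => τ.word 1 0 = 2 ^ k ∧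
      (∀ a, a ≠ 1 → τ.word a = σ.word a) ∧ τ.real = σ.real) (Nat.clog 2 n) ?_ ?_ ?_).mono
        (by simp [Test.cost, WExpr.cost]) (fun _ h => h)
    · rintro k τ hk ⟨h₁, h₂, h₃⟩
      have hlt : 2 ^ k < n := (Nat.lt_clog_iff_pow_lt (by norm_num)).1 hk
      have h₄ : τ.word 0 0 = n := by rw [h₂ 0 (by omega), hn]
      simp only [Test.Ok, Test.Holds, WExpr.Ok, WExpr.eval, h₁, h₄]
      refine ⟨⟨⟨h0, h0⟩, h0, h0⟩, hlt, ?_⟩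
      refine (Runs.of_wp ?_).mono (by simp [Program.maxCost, WExpr.cost]) (fun _ h => h)
      simp only [Program.wp, WExpr.Ok, WExpr.eval, h₁]
      refine ⟨h0, h0, ⟨⟨h0, h0⟩, ⟨h0, h0⟩, by omega⟩, ?_, fun a ha => ?_, h₃⟩
      · simp only [State.word_setWord, and_self, if_true, pow_succ]
        omega
      · rw [State.word_setWord_of_ne _ _ _ ha, h₂ a ha]
    · rintro τ ⟨h₁, h₂, -⟩
      have h₄ : τ.word 0 0 = n := by rw [h₂ 0 (by omega), hn]
      simp only [Test.Ok, Test.Holds, WExpr.Ok, WExpr.eval, h₁, h₄]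
      exact ⟨⟨⟨h0, h0⟩, h0, h0⟩, not_lt.2 (Nat.le_pow_clog (by norm_num) n)⟩
    · exact ⟨by simp, fun a ha => State.word_setWord_of_ne _ _ _ ha, rfl⟩

/-- Add one to the word variable `c` if the value at the address given by the word variable `12` of
the real array `a` is smaller than that at the address given by the word variable `11`. -/
def countStep (a c : ℕ) : Program :=
  .branch (.realLt (.cell a (.var 12)) (.cell a (.var 11)))
    (.assign c (.add (.var c) (.const 1))) .nop

/-- Compute the ranks of the coordinates of a point. -/
def computeRanks : Program :=
  .seq (.assign 9 (.const 0)) (.seq (.assign 10 (.const 0)) (.seq (.assign 12 (.const 0))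
    (.forUp 12 (.var 0) (.seq (countStep 0 9) (countStep 1 10)))))

theorem countStep_wp {a c p q N k : ℕ} {σ : State} {Q : State → Prop} (h0 : 1 < N)
    (hp : σ.word 12 0 = p) (hq : σ.word 11 0 = q) (hpN : p < N) (hqN : q < N)
    (hc : σ.word c 0 = countBelow (σ.real a) p (σ.real a q)) (hk : p < k) (hkN : k < N)
    (hQ : Q (σ.setWord c 0 (countBelow (σ.real a) (p + 1) (σ.real a q)))) :
    (countStep a c).wp N Q σ := by
  have hN : 0 < N := by omega
  have hle := countBelow_le (σ.real a) p (σ.real a q)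
  rw [countBelow_succ] at hQ
  simp only [countStep, Program.wp, Test.Ok, Test.Holds, RExpr.Ok, RExpr.eval, WExpr.Ok,
    WExpr.eval, hp, hq, hN, hpN, hqN, and_self, true_and, hc]
  refine ⟨fun hlt => ⟨⟨h0, by omega⟩, ?_⟩, fun hge => ?_⟩
  · rwa [if_pos hlt] at hQ
  · rw [if_neg hge, add_zero, ← hc] at hQ
    convert hQ using 1
    simp [State.setWord]

theorem computeRanks_runs : ∃ K, ∀ (N n q : ℕ) (σ : State), σ.word 0 0 = n → σ.word 11 0 = q →
    q < n → n + 2 < N → Runs N computeRanks σ (K * (n + 1)) fun τ => τ.real = σ.real ∧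
      (∀ a, a ≠ 9 → a ≠ 10 → a ≠ 12 → τ.word a = σ.word a) ∧
      τ.word 9 0 = rank (σ.real 0) n q ∧ τ.word 10 0 = rank (σ.real 1) n q := by
  obtain ⟨K, hK⟩ := Runs.exists_cost (.seq (countStep 0 9) (countStep 1 10))
  refine ⟨9 + (K + 16), fun N n q σ₀ hn hq hqn hN => ?_⟩
  have h0 : 0 < N := by omega
  refine (Runs.seq (c := 3) (c' := 3 + (3 + (K + 16) * ((n + 1) * 1))) ((Runs.of_wp ?_).mono
    (by simp [Program.maxCost, WExpr.cost]) (Q := fun τ => τ = σ₀.setWord 9 0 0) ?_)).mono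
    (by nlinarith) (fun _ h => h)
  · simp only [Program.wp, WExpr.Ok, WExpr.eval]
    exact ⟨h0, h0, by omega, trivial⟩
  rintro _ rfl
  refine Runs.seq (c := 3) ((Runs.of_wp ?_).mono
    (by simp [Program.maxCost, WExpr.cost])
    (Q := fun τ => τ = (σ₀.setWord 9 0 0).setWord 10 0 0) ?_)
  · simp only [Program.wp, WExpr.Ok, WExpr.eval]
    exact ⟨h0, h0, by omega, trivial⟩
  rintro _ rfl
  refine Runs.seq (c := 3) ((Runs.of_wp ?_).mono
    (by simp [Program.maxCost, WExpr.cost])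
    (Q := fun τ => τ = ((σ₀.setWord 9 0 0).setWord 10 0 0).setWord 12 0 0) ?_)
  · simp only [Program.wp, WExpr.Ok, WExpr.eval]
    exact ⟨h0, h0, by omega, trivial⟩
  rintro _ rfl
  refine (Runs.forUp (K := K) (M := 1) (r := n + 1) (a := 0) (b := n) (fun k τ =>
    τ.real = σ₀.real ∧ (∀ a, a ≠ 9 → a ≠ 10 → a ≠ 12 → τ.word a = σ₀.word a) ∧
      τ.word 9 0 = countBelow (σ₀.real 0) k (σ₀.real 0 q) ∧
      τ.word 10 0 = countBelow (σ₀.real 1) k (σ₀.real 1 q)) (by omega) (by omega) le_rfl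
      (by omega) (by omega) ?_ ?_ (by simp) ?_).mono ?_ ?_
  · rintro k τ ⟨-, h₁, -, -⟩
    have : τ.word 0 0 = n := by rw [h₁ 0 (by omega) (by omega) (by omega), hn]
    simp only [WExpr.Ok, WExpr.eval, this]
    exact ⟨⟨h0, h0⟩, trivial⟩
  · rintro k τ - hk hτ ⟨h₁, h₂, h₃, h₄⟩
    have h₅ : τ.word 11 0 = q := by rw [h₂ 11 (by omega) (by omega) (by omega), hq]
    rw [mul_one]
    refine hK _ _ _ (Program.wp_seq.2 (countStep_wp (k := n) (by omega) hτ h₅ (by omega)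
      (by omega) (by rw [h₁, h₃]) hk (by omega) (countStep_wp (k := n) (p := k) (q := q) (by omega)
      (by simpa using hτ) (by simpa using h₅) (by omega) (by omega) (by simp [h₁, h₄]) hk
      (by omega) ?_)))
    refine ⟨by simpa using hτ, by simpa using h₁, fun a ha₁ ha₂ ha₃ => ?_, ?_, ?_⟩
    · rw [State.word_setWord_of_ne _ _ _ ha₃, State.word_setWord_of_ne _ _ _ ha₂,
        State.word_setWord_of_ne _ _ _ ha₁, h₂ a ha₁ ha₂ ha₃]
    · simp [h₁]
    · simp [h₁]
  · refine ⟨rfl, fun a ha₁ ha₂ ha₃ => ?_, ?_, ?_⟩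
    · rw [State.word_setWord_of_ne _ _ _ ha₃, State.word_setWord_of_ne _ _ _ ha₂,
        State.word_setWord_of_ne _ _ _ ha₁]
    · simp [countBelow_zero]
    · simp [countBelow_zero]
  · simp [WExpr.cost]
  · rintro τ ⟨-, h⟩
    exact h

/-- File a point under its ranks. -/
def filePoint : Program :=
  .seq (.setWord 2 (.var 9) (.var 10)) (.seq (.setWord 3 (.var 10) (.var 9))
    (.seq (.setReal 4 (.add (.var 9) (.const 1)) (.cell 0 (.var 11)))
      (.seq (.setReal 5 (.add (.var 10) (.const 1)) (.cell 1 (.var 11)))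
        (.setReal 6 (.var 9) (.cell 2 (.var 11))))))

theorem filePoint_wp {N a b q : ℕ} {σ : State} {Q : State → Prop} (hN : 1 < N)
    (h₁ : σ.word 9 0 = a) (h₂ : σ.word 10 0 = b) (h₃ : σ.word 11 0 = q) (ha : a + 1 < N)
    (hb : b + 1 < N) (hq : q < N)
    (hQ : Q (((((σ.setWord 2 a b).setWord 3 b a).setReal 4 (a + 1) (σ.real 0 q)).setReal 5 (b + 1)
      (σ.real 1 q)).setReal 6 a (σ.real 2 q))) : filePoint.wp N Q σ := by
  have h0 : 0 < N := by omega
  have ha' : a < N := by omega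
  have hb' : b < N := by omega
  simp [filePoint, Program.wp, h₁, h₂, h₃, h0, hN, ha, hb, hq, ha', hb', hQ]

/-- Compute the sorted arrays. -/
def sortPoints : Program := .forUp 11 (.var 0) (.seq computeRanks filePoint)

/-- The points with numbers below `k` have been filed. -/
structure Filed (x y w : ℕ → ℝ) (n k : ℕ) (σ : State) : Prop where
  yr : ∀ q < k, σ.word 2 (rank x n q) = rank y n q
  xr : ∀ q < k, σ.word 3 (rank y n q) = rank x n q
  X : ∀ q < k, σ.real 4 (rank x n q + 1) = x q
  Y : ∀ q < k, σ.real 5 (rank y n q + 1) = y q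
  w : ∀ q < k, σ.real 6 (rank x n q) = w q
  w_zero : ∀ c, σ.real 6 c ≠ 0 → ∃ q < k, c = rank x n q
  xr_le : ∀ r, σ.word 3 r ≤ n - 1

theorem sortPoints_runs : ∃ K, ∀ (N n : ℕ) (σ : State), σ.word 0 0 = n →
    Set.InjOn (σ.real 0) (Set.Iio n) → Set.InjOn (σ.real 1) (Set.Iio n) → n + 12 < N →
    (∀ r, σ.word 3 r = 0) → (∀ c, σ.real 6 c = 0) → σ.word 11 0 = 0 →
    Runs N sortPoints σ (K * ((n + 1) * (n + 1))) fun τ =>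
      Filed (σ.real 0) (σ.real 1) (σ.real 2) n n τ ∧ (∀ a < 4, τ.real a = σ.real a) ∧
      (∀ a < 2, τ.word a = σ.word a) ∧ ∀ a, 20 ≤ a → τ.word a = σ.word a := by
  obtain ⟨K, hK⟩ := computeRanks_runs
  obtain ⟨K', hK'⟩ := Runs.exists_cost filePoint
  refine ⟨K + K' + 16, fun N n σ₀ hn hx hy hN hxr hw h11 => ?_⟩
  have h0 : 0 < N := by omega
  obtain ⟨x, hx'⟩ : ∃ x, x = σ₀.real 0 := ⟨_, rfl⟩
  obtain ⟨y, hy'⟩ : ∃ y, y = σ₀.real 1 := ⟨_, rfl⟩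
  obtain ⟨w, hw'⟩ : ∃ w, w = σ₀.real 2 := ⟨_, rfl⟩
  rw [← hx'] at hx
  rw [← hy'] at hy
  rw [← hx', ← hy', ← hw']
  refine (Runs.forUp (K := K + K') (M := n + 1) (r := n + 1) (a := 0) (b := n) (fun k τ =>
    Filed x y w n k τ ∧ (∀ a < 4, τ.real a = σ₀.real a) ∧
      (∀ a < 2, τ.word a = σ₀.word a) ∧ ∀ a, 20 ≤ a → τ.word a = σ₀.word a) (by omega) (by omega)
      (by omega) (by omega) (by omega) ?_ ?_ h11 ?_).mono ?_ ?_
  · rintro k τ ⟨-, -, h, -⟩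
    have : τ.word 0 0 = n := by rw [h 0 (by omega), hn]
    simp only [WExpr.Ok, WExpr.eval, this]
    exact ⟨⟨h0, h0⟩, trivial⟩
  · rintro k τ - hk hτ ⟨hF, h₁, h₂, h₃⟩
    refine Runs.mono (c := K * (n + 1) + K') (Runs.seq ((hK N n k τ
      (by rw [h₂ 0 (by omega), hn]) hτ hk (by omega)).mono le_rfl ?_)) (by nlinarith)
      (fun _ h => h)
    rintro υ ⟨g₁, g₂, g₃, g₄⟩
    rw [h₁ 0 (by omega), ← hx'] at g₃
    rw [h₁ 1 (by omega), ← hy'] at g₄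
    have g₅ : υ.word 11 0 = k := by rw [g₂ 11 (by omega) (by omega) (by omega), hτ]
    have r₁ := rank_lt (f := x) hk
    have r₂ := rank_lt (f := y) hk
    have u₀ : υ.real 0 = x := by rw [g₁, h₁ 0 (by omega), hx']
    have u₁ : υ.real 1 = y := by rw [g₁, h₁ 1 (by omega), hy']
    have u₂ : υ.real 2 = w := by rw [g₁, h₁ 2 (by omega), hw']
    refine hK' _ _ _ (filePoint_wp (by omega) g₃ g₄ g₅ (by omega) (by omega) (by omega) ?_)
    rw [u₀, u₁, u₂]
    have hxne : ∀ q < k, rank x n q ≠ rank x n k := fun q hq h =>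
      hq.ne (rank_injOn hx (Set.mem_Iio.2 (hq.trans hk)) (Set.mem_Iio.2 hk) h)
    have hyne : ∀ q < k, rank y n q ≠ rank y n k := fun q hq h =>
      hq.ne (rank_injOn hy (Set.mem_Iio.2 (hq.trans hk)) (Set.mem_Iio.2 hk) h)
    have t₂ : υ.word 2 = τ.word 2 := g₂ 2 (by omega) (by omega) (by omega)
    have t₃ : υ.word 3 = τ.word 3 := g₂ 3 (by omega) (by omega) (by omega)
    have hlt : ∀ q, q < k + 1 → q ≠ k → q < k := fun q h h' => by omega
    refine ⟨by simpa using g₅, ⟨?_, ?_, ?_, ?_, ?_, ?_, ?_⟩, ?_, ?_, ?_⟩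
    · intro q hq
      by_cases hqk : q = k
      · simp [hqk]
      · simp [hxne q (hlt q hq hqk), t₂, hF.yr q (hlt q hq hqk)]
    · intro q hq
      by_cases hqk : q = k
      · simp [hqk]
      · simp [hyne q (hlt q hq hqk), t₃, hF.xr q (hlt q hq hqk)]
    · intro q hq
      by_cases hqk : q = k
      · simp [hqk]
      · simp [hxne q (hlt q hq hqk), g₁, hF.X q (hlt q hq hqk)]
    · intro q hq
      by_cases hqk : q = k
      · simp [hqk]
      · simp [hyne q (hlt q hq hqk), g₁, hF.Y q (hlt q hq hqk)]
    · intro q hq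
      by_cases hqk : q = k
      · simp [hqk]
      · simp [hxne q (hlt q hq hqk), g₁, hF.w q (hlt q hq hqk)]
    · intro c hc
      by_cases hck : c = rank x n k
      · exact ⟨k, by omega, hck⟩
      · simp [hck, g₁] at hc
        obtain ⟨q, hq, h⟩ := hF.w_zero c hc
        exact ⟨q, by omega, h⟩
    · intro r
      by_cases hr : r = rank y n k
      · simp [hr]; omega
      · simpa [hr, t₃] using hF.xr_le r
    · intro a ha
      rw [← h₁ a ha, ← g₁, State.real_setWord]
      rw [State.real_setReal_of_ne _ _ _ (by omega), State.real_setReal_of_ne _ _ _ (by omega),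
        State.real_setReal_of_ne _ _ _ (by omega)]
      rfl
    · intro a ha
      rw [← h₂ a ha, ← g₂ a (by omega) (by omega) (by omega)]
      rw [State.word_setWord_of_ne _ _ _ (by omega)]
      simp only [State.word_setReal]
      rw [State.word_setWord_of_ne _ _ _ (by omega), State.word_setWord_of_ne _ _ _ (by omega)]
    · intro a ha
      rw [← h₃ a ha, ← g₂ a (by omega) (by omega) (by omega)]
      rw [State.word_setWord_of_ne _ _ _ (by omega)]
      simp only [State.word_setReal]
      rw [State.word_setWord_of_ne _ _ _ (by omega), State.word_setWord_of_ne _ _ _ (by omega)]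
  · exact ⟨⟨by simp, by simp, by simp, by simp, by simp, fun c hc => absurd (hw c) hc,
      fun r => by simp [hxr r]⟩, fun _ _ => rfl, fun _ _ => rfl, fun _ _ => rfl⟩
  · simp [WExpr.cost]
  · rintro τ ⟨-, h⟩
    exact h

/-- Put sentinels in front of and behind the `n` sorted numbers in the cells `1`, …, `n` of the real
array `a`. -/
def addSentinels (a : ℕ) : Program :=
  .seq (.setReal a (.const 0) (.sub (.cell a (.const 1)) (.const 1)))
    (.setReal a (.add (.var 0) (.const 1)) (.add (.cell a (.var 0)) (.const 1)))

theorem addSentinels_wp {a n N : ℕ} {σ : State} {Q : State → Prop} (hN : n + 1 < N)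
    (hn : σ.word 0 0 = n) (hs : ∀ k, 1 ≤ k → k < n → σ.real a k < σ.real a (k + 1))
    (hQ : ∀ τ, τ.word = σ.word → (∀ b, b ≠ a → τ.real b = σ.real b) →
      (∀ k, 1 ≤ k → k ≤ n → τ.real a k = σ.real a k) →
      (∀ k, k ≤ n → τ.real a k < τ.real a (k + 1)) → Q τ) :
    (addSentinels a).wp N Q σ := by
  have h0 : 0 < N := by omega
  have h1 : 1 < N := by omega
  simp only [addSentinels, Program.wp, WExpr.Ok, WExpr.eval, RExpr.Ok, RExpr.eval,
    State.word_setReal, hn]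
  refine ⟨h0, h0, ⟨⟨h1, h1⟩, trivial⟩, ⟨⟨h0, h0⟩, h1, hN⟩, hN, ⟨⟨⟨h0, h0⟩, by omega⟩, trivial⟩,
    hQ _ rfl ?_ ?_ ?_⟩
  · intro b hb
    rw [State.real_setReal_of_ne _ _ _ hb, State.real_setReal_of_ne _ _ _ hb]
  · intro k h₁ h₂
    simp [show k ≠ n + 1 by omega, show k ≠ 0 by omega]
  · intro k hk
    rcases hk.eq_or_lt with rfl | hlt
    · simp
    · rcases Nat.eq_zero_or_pos k with rfl | hpos
      · simp [show n ≠ 0 by omega]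
      · simpa [show k ≠ n + 1 by omega, show k ≠ 0 by omega, show k ≠ n by omega]
          using hs k hpos hlt

/-- `D` consists of the sorted arrays for the points `(x q, y q)` with weights `w q`, `q < n`. -/
structure Data.Sorts (D : Data) (x y w : ℕ → ℝ) (n : ℕ) : Prop where
  n_eq : D.n = n
  yr : ∀ q < n, D.yr (rank x n q) = rank y n q
  X : ∀ q < n, D.X (rank x n q + 1) = x q
  Y : ∀ q < n, D.Y (rank y n q + 1) = y q
  w : ∀ q < n, D.w (rank x n q) = w q
  w_zero : ∀ c, n ≤ c → D.w c = 0
  X_lt : ∀ k, k ≤ n → D.X k < D.X (k + 1)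
  Y_lt : ∀ k, k ≤ n → D.Y k < D.Y (k + 1)

/-- Prepare the data for the search. -/
def prepare : Program :=
  .seq computeSize (.seq sortPoints (.seq (addSentinels 4) (addSentinels 5)))

theorem prepare_runs : ∃ K, ∀ (N n : ℕ) (σ : State), σ.word 0 0 = n →
    Set.InjOn (σ.real 0) (Set.Iio n) → Set.InjOn (σ.real 1) (Set.Iio n) → 4 * n + 12 < N →
    (∀ a i, 1 ≤ a → σ.word a i = 0) → (∀ a i, 3 ≤ a → σ.real a i = 0) →
    Runs N prepare σ (K * ((n + 1) * (n + 1) * (Nat.clog 2 n + 1))) fun τ =>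
      ∃ D : Data, D.Holds τ ∧ D.Attained τ ∧ D.Good (Nat.clog 2 n) ∧
        D.Sorts (σ.real 0) (σ.real 1) (σ.real 2) n := by
  obtain ⟨K, hK⟩ := sortPoints_runs
  obtain ⟨K', hK'⟩ := Runs.exists_cost (.seq (addSentinels 4) (addSentinels 5))
  refine ⟨20 + K + K', fun N n σ₀ hn hx hy hN hw hr => ?_⟩
  refine Runs.mono (c := 20 * (Nat.clog 2 n + 1) + (K * ((n + 1) * (n + 1)) + K'))
    (Runs.seq ((computeSize_runs hn (by omega)).mono le_rfl ?_)) ?_ (fun _ h => h)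
  swap
  · have e₁ : 1 ≤ (n + 1) * (n + 1) := Nat.mul_pos (by omega) (by omega)
    have e₂ : 1 ≤ Nat.clog 2 n + 1 := by omega
    have e₃ : Nat.clog 2 n + 1 ≤ (n + 1) * (n + 1) * (Nat.clog 2 n + 1) :=
      Nat.le_mul_of_pos_left _ e₁
    have e₄ : (n + 1) * (n + 1) ≤ (n + 1) * (n + 1) * (Nat.clog 2 n + 1) :=
      Nat.le_mul_of_pos_right _ e₂
    have e₅ := Nat.mul_le_mul_left K e₄
    have e₆ := Nat.mul_le_mul_left K' (e₁.trans e₄)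
    nlinarith
  rintro σ ⟨hm, h₁, h₂⟩
  have hK₁ := hK N n σ (by rw [h₁ 0 (by omega), hn]) (by rwa [h₂]) (by rwa [h₂]) (by omega)
    (fun r => by rw [h₁ 3 (by omega), hw _ _ (by omega)])
    (fun c => by rw [h₂, hr _ _ (by omega)])
    (by rw [h₁ 11 (by omega), hw _ _ (by omega)])
  rw [h₂] at hK₁
  refine Runs.seq (hK₁.mono le_rfl ?_)
  rintro τ ⟨hF, g₁, g₂, g₃⟩
  have hn' : τ.word 0 0 = n := by rw [g₂ 0 (by omega), h₁ 0 (by omega), hn]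
  refine hK' _ _ _ (Program.wp_seq.2 ?_)
  have hs : ∀ (f : ℕ → ℝ) (a : ℕ), Set.InjOn f (Set.Iio n) →
      (∀ q < n, τ.real a (rank f n q + 1) = f q) →
      ∀ k, 1 ≤ k → k < n → τ.real a k < τ.real a (k + 1) := by
    intro f a hf h k hk hkn
    obtain ⟨p, hp, hpk⟩ := exists_rank_eq hf (show k - 1 < n by omega)
    obtain ⟨q, hq, hqk⟩ := exists_rank_eq hf hkn
    have e₁ := h p hp
    have e₂ := h q hq
    rw [hpk, Nat.sub_add_cancel hk] at e₁
    rw [hqk] at e₂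
    rw [e₁, e₂, ← rank_lt_rank_iff hp, hpk, hqk]
    omega
  refine addSentinels_wp (by omega) hn' (hs _ 4 hx hF.X) fun υ u₁ u₂ u₃ u₄ => ?_
  refine addSentinels_wp (n := n) (by omega) (by rw [u₁, hn'])
    (fun k h h' => by rw [u₂ 5 (by omega)]; exact hs _ 5 hy hF.Y k h h') fun ρ v₁ v₂ v₃ v₄ => ?_
  have w₀ : ρ.word = τ.word := v₁.trans u₁
  have hz : ∀ a, 20 ≤ a → ρ.word a 0 = 0 := fun a ha => by
    rw [w₀, g₃ a ha, h₁ a (by omega), hw a 0 (by omega)]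
  have hm' : ρ.word 1 0 = 2 ^ Nat.clog 2 n := by rw [w₀, g₂ 1 (by omega), hm]
  have hn'' : ρ.word 0 0 = n := by rw [w₀, hn']
  have hX : ρ.real 4 = υ.real 4 := v₂ 4 (by omega)
  have hW : ρ.real 6 = τ.real 6 := (v₂ 6 (by omega)).trans (u₂ 6 (by omega))
  refine ⟨⟨n, 2 ^ Nat.clog 2 n, ρ.word 2, ρ.word 3, ρ.real 6, ρ.real 4, ρ.real 5⟩,
    ⟨hn'', hm', rfl, rfl, rfl, rfl, rfl⟩, ?_, ⟨rfl, two_pow_clog_le n, ?_, ?_⟩, ?_⟩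
  · -- The variables for the best solution are still zero: both boxes are without points.
    have hb : best ρ = 0 := by
      rw [best, v₂ 3 (by omega), u₂ 3 (by omega), g₁ 3 (by omega), hr 3 8 le_rfl]
    simp only [Data.Attained, hz _ (show 20 ≤ 20 by omega), hz _ (show 20 ≤ 21 by omega),
      hz _ (show 20 ≤ 22 by omega), hz _ (show 20 ≤ 23 by omega), hz _ (show 20 ≤ 24 by omega),
      hz _ (show 20 ≤ 25 by omega), hz _ (show 20 ≤ 26 by omega), hz _ (show 20 ≤ 27 by omega), hb]
    simp [total, Data.weight]
  · intro r
    have h₃ := hF.xr_le r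
    have h₄ := Nat.le_pow_clog (b := 2) (by norm_num) n
    have h₅ : 0 < 2 ^ Nat.clog 2 n := by positivity
    simp only [w₀]
    omega
  · intro c hc
    simp only [hW] at hc
    obtain ⟨q, hq, rfl⟩ := hF.w_zero c hc
    simp only [w₀]
    rw [hF.yr q hq, hF.xr q hq]
  · refine ⟨rfl, fun q hq => ?_, fun q hq => ?_, fun q hq => ?_, fun q hq => ?_, fun c hc => ?_,
      fun k hk => ?_, fun k hk => v₄ k hk⟩
    · simp only [w₀]
      exact hF.yr q hq
    · have := rank_lt (f := σ₀.real 0) hq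
      simp only [hX]
      rw [u₃ _ (by omega) (by omega), hF.X q hq]
    · have := rank_lt (f := σ₀.real 1) hq
      simp only
      rw [v₃ _ (by omega) (by omega), u₂ 5 (by omega), hF.Y q hq]
    · simp only [hW]
      exact hF.w q hq
    · by_contra hne
      simp only [hW] at hne
      obtain ⟨q, hq, rfl⟩ := hF.w_zero c hne
      exact absurd (rank_lt (f := σ₀.real 0) hq) (by omega)
    · simp only [hX]
      exact u₄ k hk

end TwoBoxes

/-! ### From ranks to boxes -/

namespace TwoBoxes

open RealRAM

/-- A number between `f t` and `f (t + 1)`. -/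
noncomputable def lowerThird (f : ℕ → ℝ) (t : ℕ) : ℝ := (2 * f t + f (t + 1)) / 3

/-- A larger number between `f t` and `f (t + 1)`. -/
noncomputable def upperThird (f : ℕ → ℝ) (t : ℕ) : ℝ := (f t + 2 * f (t + 1)) / 3

theorem le_of_step {f : ℕ → ℝ} {n : ℕ} (hf : ∀ k, k ≤ n → f k < f (k + 1)) {s t : ℕ} (hst : s ≤ t)
    (ht : t ≤ n + 1) : f s ≤ f t := by
  induction t, hst using Nat.le_induction with
  | base => exact le_rfl
  | succ t _ ih => exact (ih (by omega)).trans (hf t (by omega)).le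

theorem lowerThird_lt_upperThird {f : ℕ → ℝ} {n : ℕ} (hf : ∀ k, k ≤ n → f k < f (k + 1)) {s t : ℕ}
    (hst : s ≤ t) (ht : t ≤ n) : lowerThird f s < upperThird f t := by
  have h₁ := le_of_step hf hst (by omega)
  have h₂ := le_of_step hf (Nat.succ_le_succ hst) (by omega)
  have h₃ := hf s (by omega)
  simp only [Nat.succ_eq_add_one] at h₂
  rw [lowerThird, upperThird]
  linarith

theorem lowerThird_le_iff {f : ℕ → ℝ} {n : ℕ} (hf : ∀ k, k ≤ n → f k < f (k + 1)) {t r : ℕ}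
    (ht : t ≤ n) (hr : r < n) : lowerThird f t ≤ f (r + 1) ↔ t ≤ r := by
  have h := hf t ht
  rw [lowerThird]
  refine ⟨fun hle => ?_, fun hle => ?_⟩
  · by_contra hlt
    have := le_of_step hf (show r + 1 ≤ t by omega) (by omega)
    linarith
  · have := le_of_step hf (show t + 1 ≤ r + 1 by omega) (by omega)
    linarith

theorem le_upperThird_iff {f : ℕ → ℝ} {n : ℕ} (hf : ∀ k, k ≤ n → f k < f (k + 1)) {t r : ℕ}
    (ht : t ≤ n) (hr : r < n) : f (r + 1) ≤ upperThird f t ↔ r < t := by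
  have h := hf t ht
  rw [upperThird]
  refine ⟨fun hle => ?_, fun hle => ?_⟩
  · by_contra hlt
    have := le_of_step hf (show t + 1 ≤ r + 1 by omega) (by omega)
    linarith
  · have := le_of_step hf (show r + 1 ≤ t by omega) (by omega)
    linarith

/-- The points whose coordinate lies in an interval have consecutive ranks. -/
theorem exists_rank_interval (f : ℕ → ℝ) (n : ℕ) {a b : ℝ} (hab : a ≤ b) :
    ∃ i j, i ≤ j ∧ j ≤ n ∧
      ∀ q < n, (a ≤ f q ∧ f q ≤ b) ↔ (i ≤ rank f n q ∧ rank f n q < j) := by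
  classical
  refine ⟨countBelow f n a, ((Finset.range n).filter fun p => f p ≤ b).card, ?_, ?_,
    fun q hq => and_congr ⟨countBelow_mono f n, fun h => ?_⟩ ⟨fun h => ?_, fun h => ?_⟩⟩
  · unfold countBelow
    exact Finset.card_le_card
      (Finset.monotone_filter_right _ fun p _ hp => (le_of_lt hp).trans hab)
  · exact (Finset.card_filter_le _ _).trans (Finset.card_range n).le
  · by_contra hlt
    exact absurd (rank_lt_countBelow hq (not_le.1 hlt)) (not_lt.2 h)
  · unfold rank countBelow
    refine Finset.card_lt_card ((Finset.ssubset_iff_of_subset fun p hp => ?_).2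
      ⟨q, by simp [hq, h], by simp⟩)
    rw [Finset.mem_filter] at hp ⊢
    exact ⟨hp.1, hp.2.le.trans h⟩
  · by_contra hlt
    refine absurd h (not_lt.2 ?_)
    unfold rank countBelow
    exact Finset.card_le_card
      (Finset.monotone_filter_right _ fun p _ hp => lt_of_le_of_lt hp (not_le.1 hlt))

theorem xor_decide_iff (P Q R S : Prop) [Decidable P] [Decidable Q] [Decidable R] [Decidable S] :
    (xor (decide P && decide Q) (decide R && decide S)) = true ↔
      (P ∧ Q) ∧ ¬ (R ∧ S) ∨ (R ∧ S) ∧ ¬ (P ∧ Q) := by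
  by_cases P <;> by_cases Q <;> by_cases R <;> by_cases S <;> simp [*]

/-- The weight of the symmetric difference depends only on the ranks of the coordinates. -/
theorem symmDiffWeight_eq_total {n : ℕ} {p : Fin n → ℝ × ℝ} {w : Fin n → ℝ} {x y v : ℕ → ℝ}
    {D : Data} (hx : ∀ q : Fin n, x q = (p q).1) (hy : ∀ q : Fin n, y q = (p q).2)
    (hv : ∀ q : Fin n, v q = w q) (hD : D.Sorts x y v n) (hinj : Set.InjOn x (Set.Iio n))
    (hnm : n ≤ D.m) {A B : Box} {i j k l a₁ a₂ b₁ b₂ : ℕ}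
    (hAx : ∀ q < n, (A.x₁ ≤ x q ∧ x q ≤ A.x₂) ↔
      (a₁ ≤ D.m + rank x n q ∧ D.m + rank x n q < a₂))
    (hAy : ∀ q < n, (A.y₁ ≤ y q ∧ y q ≤ A.y₂) ↔ (i ≤ rank y n q ∧ rank y n q < j))
    (hBx : ∀ q < n, (B.x₁ ≤ x q ∧ x q ≤ B.x₂) ↔
      (b₁ ≤ D.m + rank x n q ∧ D.m + rank x n q < b₂))
    (hBy : ∀ q < n, (B.y₁ ≤ y q ∧ y q ≤ B.y₂) ↔ (k ≤ rank y n q ∧ rank y n q < l)) :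
    symmDiffWeight p w A B = total (D.weight i j k l) D.m (2 * D.m) a₁ a₂ b₁ b₂ := by
  classical
  rw [total, Finset.sum_Ico_eq_sum_range, show 2 * D.m - D.m = D.m by omega,
    ← Finset.sum_subset (Finset.range_subset_range.2 hnm) (fun c _ hc => ?_), ← image_rank hinj,
    Finset.sum_image (fun q hq q' hq' h => rank_injOn hinj (by simpa using hq) (by simpa using hq')
      h), Finset.sum_range, symmDiffWeight, Finset.sum_filter]
  · refine Finset.sum_congr rfl fun q _ => ?_
    have hmem : ∀ C : Box, p q ∈ C.toSet ↔
        (C.x₁ ≤ x q ∧ x q ≤ C.x₂) ∧ (C.y₁ ≤ y q ∧ y q ≤ C.y₂) := by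
      intro C
      rw [hx, hy]
      rfl
    rw [Data.weight, Nat.add_sub_cancel_left, hD.yr q q.2, hD.w q q.2, hv]
    refine if_congr ?_ rfl rfl
    rw [Set.mem_symmDiff, hmem A, hmem B, hAx q q.2, hAy q q.2, hBx q q.2, hBy q q.2]
    exact (xor_decide_iff _ _ _ _).symm
  · have : D.w c = 0 := hD.w_zero c (by simpa using hc)
    simp [Data.weight, this]

/-- The rank of an abscissa for the node kept in the word variable `c`, but at most `n`. -/
def rankExpr (c : ℕ) : WExpr :=
  .sub (.sub (.var c) (.var 1)) (.sub (.sub (.var c) (.var 1)) (.var 0))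

/-- See `lowerThird`. -/
def lowerThirdExpr (a : ℕ) (t : WExpr) : RExpr :=
  .div (.add (.mul (.const 2) (.cell a t)) (.cell a (.add t (.const 1)))) (.const 3)

/-- See `upperThird`. -/
def upperThirdExpr (a : ℕ) (t : WExpr) : RExpr :=
  .div (.add (.cell a t) (.mul (.const 2) (.cell a (.add t (.const 1))))) (.const 3)

/-- Write a real number into a cell of the output. -/
def emit (i : ℕ) (e : RExpr) : Program := .setReal 3 (.const i) e

/-- Write the coordinates of the best boxes into the output. -/
def output : Program :=
  .seq (emit 0 (lowerThirdExpr 4 (rankExpr 24))) (.seq (emit 1 (upperThirdExpr 4 (rankExpr 25)))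
  (.seq (emit 2 (lowerThirdExpr 5 (.var 20))) (.seq (emit 3 (upperThirdExpr 5 (.var 21)))
  (.seq (emit 4 (lowerThirdExpr 4 (rankExpr 26))) (.seq (emit 5 (upperThirdExpr 4 (rankExpr 27)))
  (.seq (emit 6 (lowerThirdExpr 5 (.var 22))) (emit 7 (upperThirdExpr 5 (.var 23)))))))))

theorem lowerThirdExpr_spec {a t N : ℕ} {e : WExpr} {σ : State} (ho : e.Ok N σ)
    (he : e.eval σ = t) (ht : t + 1 < N) :
    (lowerThirdExpr a e).Ok N σ ∧ (lowerThirdExpr a e).eval σ = lowerThird (σ.real a) t := by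
  simp [lowerThirdExpr, lowerThird, he, ho]
  omega

theorem upperThirdExpr_spec {a t N : ℕ} {e : WExpr} {σ : State} (ho : e.Ok N σ)
    (he : e.eval σ = t) (ht : t + 1 < N) :
    (upperThirdExpr a e).Ok N σ ∧ (upperThirdExpr a e).eval σ = upperThird (σ.real a) t := by
  simp [upperThirdExpr, upperThird, he, ho]
  omega

theorem rankExpr_spec {c N : ℕ} {σ : State} (hN : 1 < N) :
    (rankExpr c).Ok N σ ∧
      (rankExpr c).eval σ = min (σ.word c 0 - σ.word 1 0) (σ.word 0 0) := by
  simp only [rankExpr, WExpr.Ok, WExpr.eval]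
  omega

theorem output_wp {D : Data} {N : ℕ} {σ : State} {Q : State → Prop} (hN : D.n + 9 < N)
    (hD : D.Holds σ) (hA : D.Attained σ)
    (hQ : ∀ τ, τ.word = σ.word → τ.real 3 8 = σ.real 3 8 →
      τ.real 3 0 = lowerThird D.X (min (σ.word 24 0 - D.m) D.n) →
      τ.real 3 1 = upperThird D.X (min (σ.word 25 0 - D.m) D.n) →
      τ.real 3 2 = lowerThird D.Y (σ.word 20 0) →
      τ.real 3 3 = upperThird D.Y (σ.word 21 0) →
      τ.real 3 4 = lowerThird D.X (min (σ.word 26 0 - D.m) D.n) →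
      τ.real 3 5 = upperThird D.X (min (σ.word 27 0 - D.m) D.n) →
      τ.real 3 6 = lowerThird D.Y (σ.word 22 0) →
      τ.real 3 7 = upperThird D.Y (σ.word 23 0) → Q τ) : output.wp N Q σ := by
  obtain ⟨h₁, h₂, h₃, h₄, -⟩ := hA
  -- The output does not interfere with the data from which it is computed.
  obtain ⟨G, hG⟩ : ∃ G : State → Prop, ∀ τ, G τ ↔ τ.word = σ.word ∧ τ.real 4 = σ.real 4 ∧
    τ.real 5 = σ.real 5 := ⟨_, fun _ => Iff.rfl⟩
  have hE : ∀ {i : ℕ} {e : RExpr} {τ : State} {z : ℝ} {R : State → Prop}, G τ → i < N →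
      e.Ok N τ ∧ e.eval τ = z → (G (τ.setReal 3 i z) → R (τ.setReal 3 i z)) →
      (emit i e).wp N R τ := by
    rintro i e τ _ R g hi ⟨ho, rfl⟩ h
    refine ⟨hi, hi, ho, h ?_⟩
    rw [hG] at g ⊢
    rwa [State.real_setReal_of_ne _ _ _ (by omega), State.real_setReal_of_ne _ _ _ (by omega)]
  have hX : ∀ {τ : State}, G τ → ∀ c,
      ((lowerThirdExpr 4 (rankExpr c)).Ok N τ ∧ (lowerThirdExpr 4 (rankExpr c)).eval τ =
        lowerThird D.X (min (σ.word c 0 - D.m) D.n)) ∧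
      ((upperThirdExpr 4 (rankExpr c)).Ok N τ ∧ (upperThirdExpr 4 (rankExpr c)).eval τ =
        upperThird D.X (min (σ.word c 0 - D.m) D.n)) := by
    intro τ g c
    obtain ⟨hw, hr, -⟩ := (hG τ).1 g
    obtain ⟨ho, he⟩ := rankExpr_spec (c := c) (σ := τ) (N := N) (by omega)
    rw [hw, hD.n, hD.m] at he
    rw [← hr.trans hD.X]
    exact ⟨lowerThirdExpr_spec ho he (by omega), upperThirdExpr_spec ho he (by omega)⟩
  have hY : ∀ {τ : State}, G τ → ∀ c, σ.word c 0 ≤ D.n →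
      ((lowerThirdExpr 5 (.var c)).Ok N τ ∧ (lowerThirdExpr 5 (.var c)).eval τ =
        lowerThird D.Y (σ.word c 0)) ∧
      ((upperThirdExpr 5 (.var c)).Ok N τ ∧ (upperThirdExpr 5 (.var c)).eval τ =
        upperThird D.Y (σ.word c 0)) := by
    intro τ g c hc
    obtain ⟨hw, -, hr⟩ := (hG τ).1 g
    have ho : (WExpr.var c).Ok N τ := ⟨show 0 < N by omega, show 0 < N by omega⟩
    have he : (WExpr.var c).eval τ = σ.word c 0 := by simp [hw]
    rw [← hr.trans hD.Y]
    exact ⟨lowerThirdExpr_spec ho he (by omega), upperThirdExpr_spec ho he (by omega)⟩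
  have g₀ : G σ := (hG σ).2 ⟨rfl, rfl, rfl⟩
  simp only [output, Program.wp_seq]
  refine hE g₀ (by omega) (hX g₀ 24).1 fun g₁ => ?_
  refine hE g₁ (by omega) (hX g₁ 25).2 fun g₂ => ?_
  refine hE g₂ (by omega) (hY g₂ 20 (by omega)).1 fun g₃ => ?_
  refine hE g₃ (by omega) (hY g₃ 21 (by omega)).2 fun g₄ => ?_
  refine hE g₄ (by omega) (hX g₄ 26).1 fun g₅ => ?_
  refine hE g₅ (by omega) (hX g₅ 27).2 fun g₆ => ?_
  refine hE g₆ (by omega) (hY g₆ 22 (by omega)).1 fun g₇ => ?_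
  refine hE g₇ (by omega) (hY g₇ 23 (by omega)).2 fun _ => ?_
  refine hQ _ rfl ?_ ?_ ?_ ?_ ?_ ?_ ?_ ?_ ?_ <;> simp

/-- The whole program. -/
def maxWeightProgram : Program := .seq prepare (.seq search output)

theorem maxWeightProgram_runs : ∃ K, ∀ (n : ℕ) (p : Fin n → ℝ × ℝ) (w : Fin n → ℝ),
    GeneralPosition p →
    Runs (4 * n + 20) maxWeightProgram (inputState p w) (K * ((n + 1) ^ 4 * (Nat.clog 2 n + 1)))
      fun τ => ∃ A B : Box, IsOutput τ A B (symmDiffWeight p w A B) ∧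
        ∀ A' B' : Box, symmDiffWeight p w A' B' ≤ symmDiffWeight p w A B := by
  obtain ⟨K₁, hK₁⟩ := prepare_runs
  obtain ⟨K₂, hK₂⟩ := search_runs
  obtain ⟨K₃, hK₃⟩ := Runs.exists_cost output
  refine ⟨K₁ + K₂ + K₃, fun n p w hp => ?_⟩
  obtain ⟨x, hx'⟩ : ∃ x, x = (inputState p w).real 0 := ⟨_, rfl⟩
  obtain ⟨y, hy'⟩ : ∃ y, y = (inputState p w).real 1 := ⟨_, rfl⟩
  obtain ⟨v, hv'⟩ : ∃ v, v = (inputState p w).real 2 := ⟨_, rfl⟩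
  have hx : ∀ q : Fin n, x q = (p q).1 := fun q => by simp [hx', inputState]
  have hy : ∀ q : Fin n, y q = (p q).2 := fun q => by simp [hy', inputState]
  have hv : ∀ q : Fin n, v q = w q := fun q => by simp [hv', inputState]
  have hxi : Set.InjOn x (Set.Iio n) := fun q hq q' hq' h => by
    have := hp.1 (a₁ := ⟨q, hq⟩) (a₂ := ⟨q', hq'⟩) (by simpa only [← hx] using h)
    exact congrArg Fin.val this
  have hyi : Set.InjOn y (Set.Iio n) := fun q hq q' hq' h => by
    have := hp.2 (a₁ := ⟨q, hq⟩) (a₂ := ⟨q', hq'⟩) (by simpa only [← hy] using h)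
    exact congrArg Fin.val this
  have h₁ := hK₁ (4 * n + 20) n (inputState p w) (by simp [inputState]) (hx' ▸ hxi) (hy' ▸ hyi)
    (by omega) (fun a i ha => by simp [inputState, show a ≠ 0 by omega])
    (fun a i ha => by simp [inputState, show a ≠ 0 by omega, show a ≠ 1 by omega,
      show a ≠ 2 by omega])
  rw [← hx', ← hy', ← hv'] at h₁
  refine Runs.mono (Runs.seq (h₁.mono le_rfl ?_)) ?_ (fun _ h => h)
    (c := K₁ * ((n + 1) * (n + 1) * (Nat.clog 2 n + 1)) +
      (K₂ * ((n + 1) ^ 4 * (Nat.clog 2 n + 1)) + K₃))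
  swap
  · have e₁ : (n + 1) * (n + 1) ≤ (n + 1) ^ 4 := by
      rw [← sq]; exact Nat.pow_le_pow_right (by omega) (by omega)
    have e₂ := Nat.mul_le_mul_left K₁ (Nat.mul_le_mul_right (Nat.clog 2 n + 1) e₁)
    have e₃ : 1 ≤ (n + 1) ^ 4 * (Nat.clog 2 n + 1) := Nat.mul_pos (by positivity) (by omega)
    have e₄ := Nat.mul_le_mul_left K₃ e₃
    rw [add_mul (K₁ + K₂), add_mul K₁]
    omega
  rintro σ ⟨D, hD, hA, hG, hS⟩
  obtain rfl := hS.n_eq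
  have hm := hG.m_le
  have hnm : D.n ≤ D.m := by rw [hG.m_eq]; exact Nat.le_pow_clog (by norm_num) _
  refine Runs.seq ((hK₂ D _ _ σ hG (by omega) (by omega) hD hA).mono le_rfl ?_)
  rintro τ ⟨hD', hA', hbound⟩
  refine hK₃ _ _ _ (output_wp (by omega) hD' hA' fun υ _ o₈ o₀ o₁ o₂ o₃ o₄ o₅ o₆ o₇ => ?_)
  obtain ⟨c₁, c₂, c₃, c₄, c₅, c₆, c₇, c₈, c₉⟩ := hA'
  obtain ⟨A, hA⟩ : ∃ A : Box, A = ⟨_, _, _, _,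
    lowerThird_lt_upperThird hS.X_lt (s := min (τ.word 24 0 - D.m) D.n)
      (t := min (τ.word 25 0 - D.m) D.n) (by omega) (by omega),
    lowerThird_lt_upperThird hS.Y_lt c₁ c₂⟩ := ⟨_, rfl⟩
  obtain ⟨B, hB⟩ : ∃ B : Box, B = ⟨_, _, _, _,
    lowerThird_lt_upperThird hS.X_lt (s := min (τ.word 26 0 - D.m) D.n)
      (t := min (τ.word 27 0 - D.m) D.n) (by omega) (by omega),
    lowerThird_lt_upperThird hS.Y_lt c₃ c₄⟩ := ⟨_, rfl⟩
  have kx : ∀ a b q, q < D.n →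
      ((lowerThird D.X (min (a - D.m) D.n) ≤ x q ∧ x q ≤ upperThird D.X (min (b - D.m) D.n)) ↔
        (a ≤ D.m + rank x D.n q ∧ D.m + rank x D.n q < b)) := by
    intro a b q hq
    have hr := rank_lt (f := x) hq
    rw [← hS.X q hq, lowerThird_le_iff hS.X_lt (by omega) hr,
      le_upperThird_iff hS.X_lt (by omega) hr]
    omega
  have ky : ∀ a b q, q < D.n → a ≤ D.n → b ≤ D.n →
      ((lowerThird D.Y a ≤ y q ∧ y q ≤ upperThird D.Y b) ↔
        (a ≤ rank y D.n q ∧ rank y D.n q < b)) := by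
    intro a b q hq ha hb
    have hr := rank_lt (f := y) hq
    rw [← hS.Y q hq, lowerThird_le_iff hS.Y_lt ha hr, le_upperThird_iff hS.Y_lt hb hr]
  have hval : symmDiffWeight p w A B = best τ := by
    rw [c₉]
    refine symmDiffWeight_eq_total hx hy hv hS hxi hnm ?_ ?_ ?_ ?_
    · intro q hq; rw [hA]; exact kx _ _ q hq
    · intro q hq; rw [hA]; exact ky _ _ q hq (by omega) (by omega)
    · intro q hq; rw [hB]; exact kx _ _ q hq
    · intro q hq; rw [hB]; exact ky _ _ q hq (by omega) (by omega)
  refine ⟨A, B, ?_, fun A' B' => ?_⟩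
  · rw [hval]
    rw [hA, hB]
    exact ⟨o₀, o₁, o₂, o₃, o₄, o₅, o₆, o₇, o₈⟩
  · rw [hval]
    obtain ⟨i, j, hij, hj, hAy⟩ := exists_rank_interval y D.n A'.hy.le
    obtain ⟨k, l, hkl, hl, hBy⟩ := exists_rank_interval y D.n B'.hy.le
    obtain ⟨a₁, a₂, ha, ha₂, hAx⟩ := exists_rank_interval x D.n A'.hx.le
    obtain ⟨b₁, b₂, hb, hb₂, hBx⟩ := exists_rank_interval x D.n B'.hx.le
    rw [symmDiffWeight_eq_total (a₁ := D.m + a₁) (a₂ := D.m + a₂) (b₁ := D.m + b₁)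
      (b₂ := D.m + b₂) hx hy hv hS hxi hnm (fun q hq => (hAx q hq).trans (by omega)) hAy
      (fun q hq => (hBx q hq).trans (by omega)) hBy]
    exact hbound i j k l hij hj hkl hl _ _ _ _ (by omega) (by omega) (by omega) (by omega)
      (by omega) (by omega)

/-! ### Asymptotics -/

theorem clog_add_one_le {n : ℕ} (hn : 2 ≤ n) : (Nat.clog 2 n + 1 : ℝ) ≤ 8 * Real.log n := by
  have hn' : (2 : ℝ) ≤ n := by exact_mod_cast hn
  have hlog : Real.log 2 ≤ Real.log n := Real.log_le_log (by norm_num) hn'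
  have h2 := Real.log_two_gt_d9
  have h₁ : (2 : ℝ) ^ Nat.clog 2 n ≤ n ^ 3 := by
    have h := two_pow_clog_le n
    have h' : (2 : ℝ) ^ Nat.clog 2 n ≤ 2 * (n + 1) := by exact_mod_cast h
    refine h'.trans ?_
    nlinarith [mul_self_nonneg ((n : ℝ) - 2), mul_nonneg (sub_nonneg.2 hn') (sq_nonneg (n : ℝ))]
  have h₃ := Real.log_le_log (by positivity) h₁
  rw [Real.log_pow, Real.log_pow] at h₃
  push_cast at h₃
  have h₄ : (0 : ℝ) ≤ Nat.clog 2 n := Nat.cast_nonneg _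
  nlinarith

theorem isBigO_time (K : ℕ) :
    (fun n : ℕ => ((K * ((n + 1) ^ 4 * (Nat.clog 2 n + 1)) : ℕ) : ℝ)) =O[Filter.atTop]
      fun n : ℕ => (n : ℝ) ^ 4 * Real.log (n : ℝ) := by
  refine Asymptotics.IsBigO.of_bound (K * 128) ?_
  filter_upwards [Filter.eventually_ge_atTop 2] with n hn
  have hn' : (2 : ℝ) ≤ n := by exact_mod_cast hn
  have hlog : 0 ≤ Real.log n := Real.log_nonneg (by linarith)
  rw [Real.norm_of_nonneg (by positivity), Real.norm_of_nonneg (by positivity)]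
  push_cast
  have h₁ : ((n : ℝ) + 1) ^ 4 ≤ (2 * n) ^ 4 := pow_le_pow_left₀ (by positivity) (by linarith) 4
  have h₂ := mul_le_mul h₁ (clog_add_one_le hn) (by positivity) (by positivity)
  calc (K : ℝ) * (((n : ℝ) + 1) ^ 4 * (Nat.clog 2 n + 1))
      ≤ K * ((2 * n) ^ 4 * (8 * Real.log n)) := mul_le_mul_of_nonneg_left h₂ (by positivity)
    _ = K * 128 * ((n : ℝ) ^ 4 * Real.log n) := by ring

theorem isBigO_space :
    (fun n : ℕ => ((4 * n + 20 : ℕ) : ℝ)) =O[Filter.atTop] fun n : ℕ => (n : ℝ) := by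
  refine Asymptotics.IsBigO.of_bound 24 ?_
  filter_upwards [Filter.eventually_ge_atTop 1] with n hn
  have hn' : (1 : ℝ) ≤ n := by exact_mod_cast hn
  rw [Real.norm_of_nonneg (by positivity), Real.norm_of_nonneg (by positivity)]
  push_cast
  linarith

end TwoBoxes

theorem mainTheorem1 :
    ∃ (P : RealRAM.Program) (T S : ℕ → ℕ),
      (fun n : ℕ => (T n : ℝ)) =O[Filter.atTop] (fun n : ℕ => (n : ℝ) ^ 4 * Real.log (n : ℝ)) ∧
      (fun n : ℕ => (S n : ℝ)) =O[Filter.atTop] (fun n : ℕ => (n : ℝ)) ∧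
      ∀ (n : ℕ) (p : Fin n → ℝ × ℝ) (w : Fin n → ℝ), TwoBoxes.GeneralPosition p →
        ∃ (t : ℕ) (σ : RealRAM.State) (A B : TwoBoxes.Box),
          P.Exec (S n) (TwoBoxes.inputState p w) t σ ∧
          t ≤ T n ∧
          TwoBoxes.IsOutput σ A B (TwoBoxes.symmDiffWeight p w A B) ∧
          ∀ A' B' : TwoBoxes.Box,
            TwoBoxes.symmDiffWeight p w A' B' ≤ TwoBoxes.symmDiffWeight p w A B := by
  obtain ⟨K, hK⟩ := TwoBoxes.maxWeightProgram_runs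
  refine ⟨TwoBoxes.maxWeightProgram, fun n => K * ((n + 1) ^ 4 * (Nat.clog 2 n + 1)),
    fun n => 4 * n + 20, TwoBoxes.isBigO_time K, TwoBoxes.isBigO_space, fun n p w hp => ?_⟩
  obtain ⟨t, σ, hexec, ht, A, B, hout, hmax⟩ := hK n p w hp
  exact ⟨t, σ, A, B, hexec, ht, hout, hmax⟩
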